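/- Let $T$ be a measure-preserving transformation of a probability space $(X,\mathcal B,\mu)$, and write $\mu(g)=\int_X g\,d\mu$ and $g^n=g\circ T^n$. Let $f:X\to\mathbb R$ be a bounded measurable function with $\mu(f)=0$, and let $\|f\|_\infty$ be its norm in $L^\infty(\mu)$. Fix integers $N>0$ and $0\le K<N$, and set $$W=\frac1{\sqrt N}\sum_{k=0}^{N-1}f^k,\qquad W^n=W-\frac1{\sqrt N}\sum_{\substack{0\le k<N\\ |k-n|\le K}}f^k\qquad(0\le n<N).$$ Suppose that: (B1) There are constants $C_2,C_4>0$ and a non-increasing function $\rho:\mathbb N_0\to[0,\infty)$ with $\rho(0)=1$ and $\sum_{i\ge1}i\rho(i)<\infty$ such that $$|\mu(f f^k)|\le C_2\,\rho(k),\qquad |\mu(f f^l f^m f^n)|\le C_4\min\{\rho(l),\rho(n-m)\},$$ $$|\mu(f f^l f^m f^n)-\mu(f f^l)\,\mu(f^m f^n)|\le C_4\,\rho(m-l)$$ whenever $k\ge0$ and $0\le l\le m\le n<N$. (B2) There is a function $\tilde\rho:\mathbb N_0\to[0,\infty)$ such that $|\mu(f^nA(W^n))|\le\tilde\rho(K)$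 for all $0\le n<N$ and for every differentiable $A:\mathbb R\to\mathbb R$ with $A'$ absolutely continuous and $\|A\|_\infty,\|A'\|_\infty,\|A''\|_\infty\le1$. (Here $g:\mathbb R\to\mathbb R$ is absolutely continuous if it has a derivative $g'$ almost everywhere, $g'$ is locally integrable, and $g(y)=g(x)+\int_x^y g'(t)\,dt$ for all $x\le y$; $\|A''\|_\infty$ is the essential supremum.) (B3) $f$ is not a coboundary, that is, there is no $g\in L^2(\mu)$ with $f=g-g\circ T$ $\mu$-almost everywhere. Then the series in $$\sigma^2=\mu(f f)+2\sum_{n=1}^\infty\mu(f f^n)$$ converges absolutely and $\sigma^2>0$. Moreover, with $\sigma>0$ the square root of $\sigma^2$ and $Z\sim\mathcal N(0,\sigma^2)$, the Wasserstein distance $d_{\mathscr W}(W,Z)=\sup_h|\mu(h(W))-\mathbb E\,h(Z)|$, the supremum being over all $h:\mathbb R\to\mathbb R$ with $|h(x)-h(y)|\le|x-y|$ for all $x,y$, satisfies $$d_{\mathscr W}(W,Z)\le C_\#\Big(\frac{K+1}{\sqrt N}+\sum_{i=K+1}^\infty\rho(i)\Big)+C_\#'\sqrt N\,\tilde\rho(K),$$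 where $$C_\#=11\max\{\sigma^{-1},\sigma^{-2}\}\max\{C_2,\sqrt{C_4}\}\,(1+\|f\|_\infty)\sum_{i=0}^\infty(i+1)\rho(i),\qquad C_\#'=2\max\{1,\sigma^{-2}\}.$$ -/

import Mathlib

open MeasureTheory ProbabilityTheory
open scoped ENNReal NNReal

noncomputable section

namespace SteinDyn

variable {X : Type*}

/-- The function `f^n = f ∘ T^n`. -/
def iter (T : X → X) (f : X → ℝ) (n : ℕ) : X → ℝ := fun x => f (T^[n] x)

/-- The scaled sum `W = N^{-1/2} ∑_{k < N} f^k`. -/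
def W (T : X → X) (f : X → ℝ) (N : ℕ) : X → ℝ :=
  fun x => (1 / √(N : ℝ)) * ∑ k ∈ Finset.range N, iter T f k x

/-- The window `[n]_K` of all times `0 ≤ k ≤ N - 1` with `|k - n| ≤ K`. -/
def window (N K n : ℕ) : Finset ℕ :=
  (Finset.range N).filter fun k => |(k : ℤ) - (n : ℤ)| ≤ (K : ℤ)

/-- `W^n`, the scaled sum with the terms in the window `[n]_K` removed. -/
def Wgap (T : X → X) (f : X → ℝ) (N K n : ℕ) : X → ℝ :=
  fun x => W T f N x - (1 / √(N : ℝ)) * ∑ k ∈ window N K n, iter T f k x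

/-- `f` is a coboundary: `f = g - g ∘ T` for some `g ∈ L²(μ)`, as elements of `L²(μ)`. -/
def IsCoboundary [MeasurableSpace X] (μ : Measure X) (T : X → X) (f : X → ℝ) : Prop :=
  ∃ g : X → ℝ, MemLp g 2 μ ∧ f =ᵐ[μ] fun x => g x - g (T x)

/-- Absolute continuity of a function on the real line: it is differentiable almost everywhere,
its derivative is locally integrable, and it is the integral of its derivative. -/
def IsAbsCont (g : ℝ → ℝ) : Prop :=
  (∀ᵐ x, DifferentiableAt ℝ g x) ∧ LocallyIntegrable (deriv g) ∧
    ∀ x y : ℝ, x ≤ y → g y = g x + ∫ t in x..y, deriv g t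

/-- The class of test functions: differentiable `A : ℝ → ℝ` with absolutely continuous derivative
and `‖A‖_∞, ‖A'‖_∞, ‖A''‖_∞ ≤ 1`, where `A''` is defined almost everywhere. -/
def IsTestFun (A : ℝ → ℝ) : Prop :=
  Differentiable ℝ A ∧ IsAbsCont (deriv A) ∧
    (∀ x, |A x| ≤ 1) ∧ (∀ x, |deriv A x| ≤ 1) ∧ ∀ᵐ x, |deriv (deriv A) x| ≤ 1

/-- The Wasserstein distance of two laws on the real line (with finite first moments), as the
supremum of `|∫ h dν₁ - ∫ h dν₂|` over all `1`-Lipschitz `h`. It takes values in `[0, ∞]`, so that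
no default value of a real supremum interferes. -/
def wassersteinDist (ν₁ ν₂ : Measure ℝ) : ℝ≥0∞ :=
  ⨆ (h : ℝ → ℝ) (_ : ∀ x y, |h x - h y| ≤ |x - y|),
    ENNReal.ofReal |(∫ x, h x ∂ν₁) - ∫ x, h x ∂ν₂|

/-- `σ² = μ(f f) + 2 ∑_{n ≥ 1} μ(f f^n)`. -/
def variance [MeasurableSpace X] (μ : Measure X) (T : X → X) (f : X → ℝ) : ℝ :=
  (∫ x, f x * f x ∂μ) + 2 * ∑' n : ℕ, ∫ x, f x * iter T f (n + 1) x ∂μ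

/-- The `L^∞(μ)` norm of `f`. -/
def supNorm [MeasurableSpace X] (μ : Measure X) (f : X → ℝ) : ℝ :=
  (eLpNorm f ∞ μ).toReal

/-- The constant `C_#`; the argument `M` stands for `‖f‖_∞`. -/
def Csharp (σ C₂ C₄ M : ℝ) (ρ : ℕ → ℝ) : ℝ :=
  11 * max σ⁻¹ (σ ^ 2)⁻¹ * max C₂ (√C₄) * (1 + M) * ∑' i : ℕ, ((i : ℝ) + 1) * ρ i

/-- The constant `C_#'`. -/
def Csharp' (σ : ℝ) : ℝ := 2 * max 1 (σ ^ 2)⁻¹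

end SteinDyn

end

/-! The proof is Stein's method with a gap in time. For a 1-Lipschitz `h` one solves `σ² A' x - x A
x = h x - E h(Z)` with `|A| ≤ 1`, `|A'| ≤ (11/8) σ⁻¹` and `A'` Lipschitz with constant `2 σ⁻²`
(`exists_stein`); it remains to bound the mean of `σ² A'(W) - W A(W)`. Expanding `A(W)` around
`A(W^n)` in each summand of `W A(W) = N^{-1/2} ∑ f^n A(W)` leaves three terms
(`abs_integral_stein_le`). The term with `A'(W)` multiplies `σ² - N⁻¹ ∑_n ∑_{k ∈ [n]_K} f^n f^k`,
which is small in `L¹`: its mean is controlled by the tails of `ρ`, its fluctuation by fourth-order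
correlations and Cauchy–Schwarz (`abs_variance_sub_window_le`, `integral_sq_window_le`). The terms
`f^n A(W^n)` are (B2) for a multiple of `A`. The Taylor remainders are quadratic in `W - W^n`, a
window sum whose second moment is of order `(K+1)/N`. For `σ² > 0`: the second moment of the `L`-th
Birkhoff sum is `L σ²` up to an error independent of `L`. If `σ² ≤ 0`, the sums are therefore
bounded in `L²`, and a weak limit of their averages exhibits `f` as a coboundary
(`isCoboundary_of_bounded`), against (B3). -/

namespace SteinDyn

open Set Filter Topology

/-! ### The Gaussian weight and Mills ratio bounds. -/

/-- The unnormalised standard Gaussian density. -/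
noncomputable def gaussWeight (t : ℝ) : ℝ := Real.exp (-(1 / 2) * t ^ 2)

/-- The solution of the Stein equation `F' x - x * F x = u x`. -/
noncomputable def steinSol (u : ℝ → ℝ) (x : ℝ) : ℝ :=
  Real.exp (x ^ 2 / 2) * ∫ t in Iic x, u t * gaussWeight t

lemma gaussWeight_pos (t : ℝ) : 0 < gaussWeight t := Real.exp_pos _

lemma gaussWeight_neg (t : ℝ) : gaussWeight (-t) = gaussWeight t := by simp [gaussWeight]

lemma exp_mul_gaussWeight (x : ℝ) : Real.exp (x ^ 2 / 2) * gaussWeight x = 1 := by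
  rw [gaussWeight, ← Real.exp_add]; ring_nf; simp

lemma hasDerivAt_gaussWeight (x : ℝ) : HasDerivAt gaussWeight (-x * gaussWeight x) x := by
  have h : HasDerivAt (fun t : ℝ => -(1 / 2) * t ^ 2) (-x) x := by
    refine ((hasDerivAt_pow 2 x).const_mul (-(1 / 2) : ℝ)).congr_deriv ?_
    norm_num
    ring
  refine h.exp.congr_deriv ?_
  rw [gaussWeight]; ring

lemma continuous_gaussWeight : Continuous gaussWeight := by unfold gaussWeight; fun_prop

lemma integrable_gaussWeight : Integrable gaussWeight :=
  integrable_exp_neg_mul_sq (by norm_num)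

lemma integrable_id_mul_gaussWeight : Integrable fun t => t * gaussWeight t :=
  integrable_mul_exp_neg_mul_sq (by norm_num)

lemma tendsto_gaussWeight_atTop : Tendsto gaussWeight atTop (𝓝 0) := by
  refine Real.tendsto_exp_atBot.comp ?_
  exact (tendsto_pow_atTop (two_ne_zero)).const_mul_atTop_of_neg (by norm_num)

lemma integral_Ioi_id_mul_gaussWeight (x : ℝ) :
    ∫ t in Ioi x, t * gaussWeight t = gaussWeight x := by
  have h := integral_Ioi_of_hasDerivAt_of_tendsto' (a := x) (m := 0)
    (f := fun t => - gaussWeight t) (f' := fun t => t * gaussWeight t)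
    (fun t _ => (hasDerivAt_gaussWeight t).neg.congr_deriv (by ring))
    integrable_id_mul_gaussWeight.integrableOn (by simpa using tendsto_gaussWeight_atTop.neg)
  simpa using h

/-- The lower bound for the Mills ratio. -/
lemma mul_gaussWeight_le_tail (x : ℝ) :
    x * gaussWeight x ≤ (1 + x ^ 2) * ∫ t in Ioi x, gaussWeight t := by
  -- `G` is the derivative of `-(t / (1 + t ^ 2)) * gaussWeight t`, and it lies below the weight;
  -- integrating over the tail gives the bound.
  set G : ℝ → ℝ := fun t => (1 - 2 / (1 + t ^ 2) ^ 2) * gaussWeight t with hG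
  have hb (t : ℝ) : 0 ≤ 2 / (1 + t ^ 2) ^ 2 ∧ 2 / (1 + t ^ 2) ^ 2 ≤ 2 := by
    refine ⟨by positivity, ?_⟩
    rw [div_le_iff₀ (by positivity)]
    nlinarith [sq_nonneg t, sq_nonneg (t ^ 2)]
  have hcont : Continuous G := by
    refine Continuous.mul (continuous_const.sub (continuous_const.div (by fun_prop) ?_))
      continuous_gaussWeight
    intro t; positivity
  have hint : Integrable G := by
    refine integrable_gaussWeight.mono hcont.aestronglyMeasurable (ae_of_all _ fun t => ?_)
    rw [hG, norm_mul]
    refine mul_le_of_le_one_left (norm_nonneg _) ?_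
    rw [Real.norm_eq_abs, abs_le]
    constructor <;> linarith [(hb t).1, (hb t).2]
  have hderiv (t : ℝ) : HasDerivAt (fun s => - (s / (1 + s ^ 2) * gaussWeight s)) (G t) t := by
    have h1 : HasDerivAt (fun s : ℝ => 1 + s ^ 2) (2 * t) t := by
      simpa using (hasDerivAt_pow 2 t).const_add 1
    have h2 := ((hasDerivAt_id t).div h1 (by positivity)).mul (hasDerivAt_gaussWeight t)
    refine h2.neg.congr_deriv ?_
    simp only [hG, id, Pi.div_apply]
    have : (1 + t ^ 2) ≠ 0 := by positivity
    field_simp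
    ring
  have hlim : Tendsto (fun s => - (s / (1 + s ^ 2) * gaussWeight s)) atTop (𝓝 0) := by
    refine squeeze_zero_norm (fun s => ?_) tendsto_gaussWeight_atTop
    rw [norm_neg, norm_mul, Real.norm_of_nonneg (gaussWeight_pos s).le]
    refine mul_le_of_le_one_left (gaussWeight_pos s).le ?_
    rw [norm_div, Real.norm_of_nonneg (by positivity : 0 ≤ 1 + s ^ 2),
      div_le_one (by positivity), Real.norm_eq_abs]
    nlinarith [sq_abs s, sq_nonneg (|s| - 1)]
  have key := integral_Ioi_of_hasDerivAt_of_tendsto' (a := x) (fun t _ => hderiv t)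
    hint.integrableOn hlim
  have hle : ∫ t in Ioi x, G t ≤ ∫ t in Ioi x, gaussWeight t := by
    refine integral_mono hint.integrableOn integrable_gaussWeight.integrableOn fun t => ?_
    refine mul_le_of_le_one_left (gaussWeight_pos t).le ?_
    linarith [(hb t).1]
  rw [key, zero_sub, neg_neg, div_mul_eq_mul_div, div_le_iff₀ (by positivity)] at hle
  linarith

/-- The upper bound for the Mills ratio. -/
lemma mul_tail_le_gaussWeight (x : ℝ) :
    x * ∫ t in Ioi x, gaussWeight t ≤ gaussWeight x := by
  rw [← integral_Ioi_id_mul_gaussWeight x, ← integral_const_mul]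
  refine setIntegral_mono_on (integrable_gaussWeight.const_mul x).integrableOn
    integrable_id_mul_gaussWeight.integrableOn measurableSet_Ioi fun t ht => ?_
  exact mul_le_mul_of_nonneg_right (le_of_lt ht) (gaussWeight_pos t).le

/-! ### Bounds on the standard Stein solution for centred Lipschitz data. -/

section Solution

variable {u : ℝ → ℝ}

/-- Centring allows integration from either end, so at each point the tail on which the sign or size
of `u` is controlled can be used. -/
lemma steinSol_eq_tail (hi : Integrable fun t => u t * gaussWeight t)
    (h0 : ∫ t, u t * gaussWeight t = 0) (x : ℝ) :
    steinSol u x = -(Real.exp (x ^ 2 / 2) * ∫ t in Ioi x, u t * gaussWeight t) := by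
  have h := intervalIntegral.integral_Iic_add_Ioi (b := x) hi.integrableOn hi.integrableOn
  rw [h0] at h
  rw [steinSol, eq_neg_of_add_eq_zero_left h]; ring

lemma integrable_reflect (hi : Integrable fun t => u t * gaussWeight t) :
    Integrable fun t => -u (-t) * gaussWeight t := by
  have := hi.comp_neg.neg
  refine this.congr (ae_of_all _ fun t => ?_)
  simp [gaussWeight_neg]

lemma integral_reflect (h0 : ∫ t, u t * gaussWeight t = 0) :
    ∫ t, -u (-t) * gaussWeight t = 0 := by
  have := integral_neg_eq_self (fun t => u t * gaussWeight t) volume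
  simp only [gaussWeight_neg] at this
  simp only [neg_mul, integral_neg, this, h0, neg_zero]

lemma steinSol_reflect (hi : Integrable fun t => u t * gaussWeight t)
    (h0 : ∫ t, u t * gaussWeight t = 0) (x : ℝ) :
    steinSol (fun t => -u (-t)) x = steinSol u (-x) := by
  rw [steinSol_eq_tail hi h0, steinSol]
  have := integral_comp_neg_Iic x (fun t => u t * gaussWeight t)
  simp only [gaussWeight_neg] at this
  simp only [neg_mul, integral_neg, this, even_two.neg_pow, mul_neg]

lemma hasDerivAt_steinSol (hc : Continuous u) (hi : Integrable fun t => u t * gaussWeight t)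
    (x : ℝ) : HasDerivAt (steinSol u) (x * steinSol u x + u x) x := by
  have hcu : Continuous fun t => u t * gaussWeight t := hc.mul continuous_gaussWeight
  have h1 : HasDerivAt (fun y => ∫ t in Iic y, u t * gaussWeight t) (u x * gaussWeight x) x := by
    have h2 : (fun y => ∫ t in Iic y, u t * gaussWeight t) = fun y =>
        (∫ t in Iic 0, u t * gaussWeight t) + ∫ t in (0 : ℝ)..y, u t * gaussWeight t := by
      funext y
      rw [← intervalIntegral.integral_Iic_sub_Iic hi.integrableOn hi.integrableOn]; ring
    rw [h2]
    exact (intervalIntegral.integral_hasDerivAt_right (hcu.intervalIntegrable _ _)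
      (hcu.stronglyMeasurableAtFilter _ _) hcu.continuousAt).const_add _
  have h3 : HasDerivAt (fun y : ℝ => Real.exp (y ^ 2 / 2)) (Real.exp (x ^ 2 / 2) * x) x := by
    have : HasDerivAt (fun y : ℝ => y ^ 2 / 2) x x := by
      refine ((hasDerivAt_pow 2 x).div_const 2).congr_deriv ?_
      norm_num
    exact this.exp
  refine (h3.mul h1).congr_deriv ?_
  rw [steinSol]
  linear_combination u x * exp_mul_gaussWeight x

/-- By monotonicity `u` keeps its sign on the left tail if `u x ≤ 0`, and on the right tail if `u x
≥ 0`. -/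
lemma steinSol_nonpos (hi : Integrable fun t => u t * gaussWeight t)
    (h0 : ∫ t, u t * gaussWeight t = 0) (hm : Monotone u) (x : ℝ) : steinSol u x ≤ 0 := by
  rcases le_total (u x) 0 with h | h
  · refine mul_nonpos_of_nonneg_of_nonpos (Real.exp_pos _).le ?_
    refine setIntegral_nonpos measurableSet_Iic fun t ht => ?_
    exact mul_nonpos_of_nonpos_of_nonneg ((hm ht).trans h) (gaussWeight_pos t).le
  · rw [steinSol_eq_tail hi h0, neg_nonpos]
    refine mul_nonneg (Real.exp_pos _).le (setIntegral_nonneg measurableSet_Ioi fun t ht => ?_)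
    exact mul_nonneg (h.trans (hm (le_of_lt ht))) (gaussWeight_pos t).le

/-- With `F = steinSol u`, the left side is the derivative of `x * F x`. If `u x ≤ 0`, both summands
are nonpositive; otherwise `u ≥ u x` on the right tail and the lower Mills bound applies. -/
lemma deriv_mul_steinSol_nonpos_of_nonneg (hi : Integrable fun t => u t * gaussWeight t)
    (h0 : ∫ t, u t * gaussWeight t = 0) (hm : Monotone u) {x : ℝ} (hx : 0 ≤ x) :
    steinSol u x * (1 + x ^ 2) + x * u x ≤ 0 := by
  rcases le_total (u x) 0 with h | h
  · have := steinSol_nonpos hi h0 hm x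
    nlinarith [mul_nonneg hx (neg_nonneg.2 h), mul_nonneg (neg_nonneg.2 this) (sq_nonneg x)]
  · have h1 : u x * ∫ t in Ioi x, gaussWeight t ≤ ∫ t in Ioi x, u t * gaussWeight t := by
      rw [← integral_const_mul]
      refine setIntegral_mono_on (integrable_gaussWeight.const_mul _).integrableOn
        hi.integrableOn measurableSet_Ioi fun t ht => ?_
      exact mul_le_mul_of_nonneg_right (hm (le_of_lt ht)) (gaussWeight_pos t).le
    have h2 := mul_le_mul_of_nonneg_left (mul_gaussWeight_le_tail x) h
    have h3 : x * u x * gaussWeight x ≤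
        (1 + x ^ 2) * ∫ t in Ioi x, u t * gaussWeight t := by
      calc x * u x * gaussWeight x = u x * (x * gaussWeight x) := by ring
        _ ≤ u x * ((1 + x ^ 2) * ∫ t in Ioi x, gaussWeight t) := h2
        _ = (1 + x ^ 2) * (u x * ∫ t in Ioi x, gaussWeight t) := by ring
        _ ≤ _ := mul_le_mul_of_nonneg_left h1 (by positivity)
    have h4 := mul_le_mul_of_nonneg_left h3 (Real.exp_pos (x ^ 2 / 2)).le
    rw [steinSol_eq_tail hi h0]
    have h5 := exp_mul_gaussWeight x
    have h6 : Real.exp (x ^ 2 / 2) * (x * u x * gaussWeight x) = x * u x := by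
      linear_combination (x * u x) * h5
    rw [h6] at h4
    linarith

lemma deriv_mul_steinSol_nonpos (hi : Integrable fun t => u t * gaussWeight t)
    (h0 : ∫ t, u t * gaussWeight t = 0) (hm : Monotone u) (x : ℝ) :
    steinSol u x * (1 + x ^ 2) + x * u x ≤ 0 := by
  rcases le_total 0 x with hx | hx
  · exact deriv_mul_steinSol_nonpos_of_nonneg hi h0 hm hx
  · have := deriv_mul_steinSol_nonpos_of_nonneg (integrable_reflect hi) (integral_reflect h0)
      (fun a b hab => neg_le_neg (hm (neg_le_neg hab))) (neg_nonneg.2 hx)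
    rw [steinSol_reflect hi h0] at this
    simpa using this

lemma integral_id_mul_gaussWeight : ∫ t, t * gaussWeight t = 0 := by
  have := integral_neg_eq_self (fun t => t * gaussWeight t) volume
  simp only [gaussWeight_neg, neg_mul, integral_neg] at this
  linarith

lemma steinSol_id (x : ℝ) : steinSol (fun t => t) x = -1 := by
  rw [steinSol_eq_tail (u := fun t => t) integrable_id_mul_gaussWeight integral_id_mul_gaussWeight,
    integral_Ioi_id_mul_gaussWeight, exp_mul_gaussWeight]

lemma steinSol_add {v : ℝ → ℝ} (hi : Integrable fun t => u t * gaussWeight t)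
    (hv : Integrable fun t => v t * gaussWeight t) (x : ℝ) :
    steinSol (fun t => u t + v t) x = steinSol u x + steinSol v x := by
  simp only [steinSol, add_mul]
  rw [integral_add hi.integrableOn hv.integrableOn, mul_add]

lemma steinSol_neg (x : ℝ) : steinSol (fun t => -u t) x = -steinSol u x := by
  simp only [steinSol, neg_mul, integral_neg, mul_neg]

/-- Bounds on the solution of the Stein equation for `1`-Lipschitz data, in one direction. -/
lemma steinSol_le_one (hi : Integrable fun t => u t * gaussWeight t)
    (h0 : ∫ t, u t * gaussWeight t = 0) (hL : ∀ x y, |u x - u y| ≤ |x - y|) (x : ℝ) :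
    steinSol u x ≤ 1 ∧ steinSol u x * (1 + x ^ 2) + x * u x ≤ 1 := by
  -- For 1-Lipschitz `u` the function `t + u t` is monotone, and the solution for the identity is
  -- the constant `-1`; the two sign statements for monotone data thus become upper bounds by 1.
  have hi' : Integrable fun t => (t + u t) * gaussWeight t := by
    simp only [add_mul]; exact integrable_id_mul_gaussWeight.add hi
  have h0' : ∫ t, (t + u t) * gaussWeight t = 0 := by
    simp only [add_mul]
    rw [integral_add integrable_id_mul_gaussWeight hi, h0, integral_id_mul_gaussWeight, add_zero]
  have hm : Monotone fun t => t + u t := by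
    intro a b hab
    have h1 := hL a b
    rw [abs_sub_comm a b, abs_of_nonneg (sub_nonneg.2 hab)] at h1
    have := le_abs_self (u a - u b)
    show a + u a ≤ b + u b
    linarith
  have e := steinSol_add (u := fun t => t) integrable_id_mul_gaussWeight hi x
  rw [steinSol_id] at e
  have h1 := steinSol_nonpos hi' h0' hm x
  have h2 := deriv_mul_steinSol_nonpos hi' h0' hm x
  rw [e] at h1 h2
  exact ⟨by linarith, by linarith⟩

/-- Applies the one-sided bounds to `u` and `-u`. The second bound makes `x * F x` 1-Lipschitz, so
that `F' = x * F + u` is 2-Lipschitz even though `u` need not be differentiable. -/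
lemma abs_steinSol_le_one (hi : Integrable fun t => u t * gaussWeight t)
    (h0 : ∫ t, u t * gaussWeight t = 0) (hL : ∀ x y, |u x - u y| ≤ |x - y|) (x : ℝ) :
    |steinSol u x| ≤ 1 ∧ |steinSol u x * (1 + x ^ 2) + x * u x| ≤ 1 := by
  have h1 := steinSol_le_one hi h0 hL x
  have h2 := steinSol_le_one (u := fun t => -u t) (by simp only [neg_mul]; exact hi.neg)
    (by simp only [neg_mul, integral_neg, h0, neg_zero])
    (fun x y => by rw [← neg_sub', abs_neg]; exact hL x y) x
  rw [steinSol_neg] at h2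
  exact ⟨abs_le.2 ⟨by linarith, h1.1⟩, abs_le.2 ⟨by linarith, h1.2⟩⟩

/-- Writing `F'` in terms of the tail integral of `u t - u x` leaves the factor `r = 1 - x * (E *
I)`, which the Mills bounds place between 0 and `1 / (1 + x ^ 2)`. -/
lemma abs_deriv_steinSol_le_of_nonneg (hi : Integrable fun t => u t * gaussWeight t)
    (h0 : ∫ t, u t * gaussWeight t = 0) (hL : ∀ x y, |u x - u y| ≤ |x - y|)
    {x : ℝ} (hx : 0 ≤ x) (hu : |u x| ≤ √(1 + x ^ 2)) :
    |x * steinSol u x + u x| ≤ 11 / 8 := by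
  set E := Real.exp (x ^ 2 / 2)
  set I := ∫ t in Ioi x, gaussWeight t
  set J := ∫ t in Ioi x, u t * gaussWeight t
  have hE : 0 < E := Real.exp_pos _
  have hEG : E * gaussWeight x = 1 := exp_mul_gaussWeight x
  have hsol : steinSol u x = -(E * J) := steinSol_eq_tail hi h0 x
  have hJ : |J - u x * I| ≤ gaussWeight x - x * I := by
    have e1 : J - u x * I = ∫ t in Ioi x, (u t - u x) * gaussWeight t := by
      simp only [sub_mul]
      rw [integral_sub hi.integrableOn (integrable_gaussWeight.const_mul _).integrableOn,
        integral_const_mul]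
    have e2 : gaussWeight x - x * I = ∫ t in Ioi x, (t - x) * gaussWeight t := by
      simp only [sub_mul]
      rw [integral_sub integrable_id_mul_gaussWeight.integrableOn
        (integrable_gaussWeight.const_mul _).integrableOn, integral_const_mul,
        integral_Ioi_id_mul_gaussWeight]
    rw [e1, e2]
    refine (abs_integral_le_integral_abs).trans (setIntegral_mono_on ?_ ?_ measurableSet_Ioi ?_)
    · simp only [sub_mul]
      exact (hi.sub (integrable_gaussWeight.const_mul _)).abs.integrableOn
    · simp only [sub_mul]
      exact (integrable_id_mul_gaussWeight.sub (integrable_gaussWeight.const_mul _)).integrableOn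
    · intro t ht
      rw [abs_mul, abs_of_pos (gaussWeight_pos t)]
      refine mul_le_mul_of_nonneg_right ?_ (gaussWeight_pos t).le
      exact (hL t x).trans_eq (abs_of_pos (sub_pos.2 ht))
  set r := 1 - x * (E * I) with hr
  have hr0 : 0 ≤ r := by
    have := mul_le_mul_of_nonneg_left (mul_tail_le_gaussWeight x) hE.le
    rw [hEG] at this
    have e : E * (x * I) = x * (E * I) := by ring
    rw [e] at this
    linarith
  have hr1 : r * (1 + x ^ 2) ≤ 1 := by
    have := mul_le_mul_of_nonneg_left (mul_gaussWeight_le_tail x) hE.le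
    have e : E * (x * gaussWeight x) = x := by linear_combination x * hEG
    rw [e] at this
    have e2 : E * ((1 + x ^ 2) * I) = (1 + x ^ 2) * (E * I) := by ring
    rw [e2] at this
    have := mul_le_mul_of_nonneg_left this hx
    nlinarith
  have hEJ : |E * J - u x * (E * I)| ≤ r := by
    have := mul_le_mul_of_nonneg_left hJ hE.le
    rw [← abs_of_pos hE, ← abs_mul, abs_of_pos hE] at this
    calc _ = |E * (J - u x * I)| := by congr 1; ring
      _ ≤ _ := this
      _ = r := by rw [hr]; linear_combination hEG
  set s := √(1 + x ^ 2) with hs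
  have hs2 : s ^ 2 = 1 + x ^ 2 := Real.sq_sqrt (by positivity)
  have hs1 : 1 ≤ s := Real.one_le_sqrt.2 (by nlinarith)
  have hmain : |x * steinSol u x + u x| ≤ (x + s) * r := by
    have e : x * steinSol u x + u x = u x * r - x * (E * J - u x * (E * I)) := by
      rw [hsol, hr]; ring
    rw [e]
    calc _ ≤ |u x * r| + |x * (E * J - u x * (E * I))| := abs_sub _ _
      _ ≤ s * r + x * r := by
        rw [abs_mul, abs_mul, abs_of_nonneg hr0, abs_of_nonneg hx]
        gcongr
      _ = _ := by ring
  refine hmain.trans ?_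
  rw [← hs2] at hr1
  -- The maximum of `(x + s) / s ^ 2` is `3√3/4 ≈ 1.299`, at `x = 1/√3`. The rounder value `11/8`
  -- later meets a factor 8 and gives the 11 in `Csharp`.
  have hxs : x + s ≤ 11 / 8 * s ^ 2 := by
    have h1 : x ≤ 11 / 8 * s ^ 2 - s := by
      refine abs_le_of_sq_le_sq' ?_ (by nlinarith) |>.2
      have : x ^ 2 = s ^ 2 - 1 := by linarith
      rw [this]
      nlinarith [sq_nonneg (s ^ 2 - 8 / 11 * s - 1 / 2), sq_nonneg (s - 1.15),
        sq_nonneg (s * (s - 1.1))]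
    linarith
  calc (x + s) * r ≤ 11 / 8 * s ^ 2 * r := by gcongr
    _ = 11 / 8 * (r * s ^ 2) := by ring
    _ ≤ 11 / 8 * 1 := by gcongr
    _ = _ := by ring

lemma abs_deriv_steinSol_le (hi : Integrable fun t => u t * gaussWeight t)
    (h0 : ∫ t, u t * gaussWeight t = 0) (hL : ∀ x y, |u x - u y| ≤ |x - y|)
    (hu : ∀ x, |u x| ≤ √(1 + x ^ 2)) (x : ℝ) :
    |x * steinSol u x + u x| ≤ 11 / 8 := by
  rcases le_total 0 x with hx | hx
  · exact abs_deriv_steinSol_le_of_nonneg hi h0 hL hx (hu x)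
  · have := abs_deriv_steinSol_le_of_nonneg (integrable_reflect hi) (integral_reflect h0)
      (fun a b => ?_) (neg_nonneg.2 hx) (by simpa using hu x)
    · rw [steinSol_reflect hi h0, neg_neg, ← abs_neg] at this
      convert this using 2; ring
    · have := hL (-a) (-b)
      rw [← abs_neg] at this
      calc _ = |-(u (-a) - u (-b))| := by congr 1; ring
        _ ≤ _ := this
        _ = |-(a - b)| := by congr 1; ring
        _ = _ := abs_neg _

end Solution

/-! ### Solving the Stein equation for Gaussian laws. -/

lemma integral_gaussianReal_zero_one (g : ℝ → ℝ) :
    ∫ x, g x ∂gaussianReal 0 1 = (√(2 * Real.pi))⁻¹ * ∫ x, g x * gaussWeight x := by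
  rw [integral_gaussianReal_eq_integral_smul one_ne_zero, ← integral_const_mul]
  refine integral_congr_ae (ae_of_all _ fun x => ?_)
  simp only [gaussianPDFReal, gaussWeight, smul_eq_mul, NNReal.coe_one, mul_one, sub_zero]
  rw [show -x ^ 2 / 2 = -(1 / 2) * x ^ 2 by ring]
  ring

lemma integrable_id_gaussianReal (v : ℝ≥0) : Integrable (fun x => x) (gaussianReal 0 v) :=
  memLp_one_iff_integrable.1 (memLp_id_gaussianReal' 1 (by simp))

lemma integral_sub_sq_gaussianReal (x : ℝ) :
    Integrable (fun t => (x - t) ^ 2) (gaussianReal 0 1) ∧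
      ∫ t, (x - t) ^ 2 ∂gaussianReal 0 1 = 1 + x ^ 2 := by
  have h2 : Integrable (fun t : ℝ => t ^ 2) (gaussianReal 0 1) :=
    (memLp_id_gaussianReal' (μ := 0) (v := 1) 2 (by simp)).integrable_sq
  have h1 := (integrable_id_gaussianReal 1).const_mul (2 * x)
  have hv : ∫ t, t ^ 2 ∂gaussianReal 0 1 = 1 := by
    have := variance_id_gaussianReal (μ := 0) (v := 1)
    rw [variance_of_integral_eq_zero aemeasurable_id (by simp)] at this
    simpa using this
  have e : (fun t : ℝ => (x - t) ^ 2) = fun t => x ^ 2 - 2 * x * t + t ^ 2 := by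
    funext t; ring
  rw [e]
  have h3 : Integrable (fun t : ℝ => x ^ 2 - 2 * x * t) (gaussianReal 0 1) :=
    (integrable_const _).sub h1
  refine ⟨h3.add h2, ?_⟩
  rw [integral_add h3 h2, integral_sub (integrable_const _) h1, integral_const_mul, hv]
  simp [add_comm]

lemma continuous_of_abs_sub_le {h : ℝ → ℝ} {c : ℝ} (hL : ∀ x y, |h x - h y| ≤ c * |x - y|) :
    Continuous h :=
  (LipschitzWith.of_dist_le' (K := c) fun x y => by
    simpa only [Real.dist_eq] using hL x y).continuous

lemma integrable_gaussianReal_of_lipschitz {h : ℝ → ℝ} (hL : ∀ x y, |h x - h y| ≤ |x - y|)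
    (v : ℝ≥0) : Integrable h (gaussianReal 0 v) := by
  have hc : Continuous h := continuous_of_abs_sub_le (c := 1) (by simpa using hL)
  refine ((integrable_const |h 0|).add (integrable_id_gaussianReal v).abs).mono'
    hc.aestronglyMeasurable (ae_of_all _ fun t => ?_)
  have := hL t 0
  rw [sub_zero] at this
  calc ‖h t‖ = |h 0 + (h t - h 0)| := by rw [Real.norm_eq_abs]; congr 1; ring
    _ ≤ |h 0| + |h t - h 0| := abs_add_le _ _
    _ ≤ |h 0| + |t| := by gcongr

/-- Solution of the Stein equation for the standard Gaussian, with bounds. -/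
lemma exists_stein_standard {k : ℝ → ℝ} (hL : ∀ x y, |k x - k y| ≤ |x - y|) :
    ∃ F F' : ℝ → ℝ, (∀ x, HasDerivAt F (F' x) x) ∧ (∀ x, |F x| ≤ 1) ∧ (∀ x, |F' x| ≤ 11 / 8) ∧
      (∀ x y, |F' x - F' y| ≤ 2 * |x - y|) ∧
      ∀ x, F' x - x * F x = k x - ∫ t, k t ∂gaussianReal 0 1 := by
  set c := ∫ t, k t ∂gaussianReal 0 1 with hcdef
  set u : ℝ → ℝ := fun t => k t - c with hu
  have hLu : ∀ x y, |u x - u y| ≤ |x - y| := fun x y => by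
    simpa only [hu, sub_sub_sub_cancel_right] using hL x y
  have hcont : Continuous u := continuous_of_abs_sub_le (c := 1) (by simpa using hLu)
  have hig : Integrable k (gaussianReal 0 1) := integrable_gaussianReal_of_lipschitz hL 1
  have hi : Integrable fun t => u t * gaussWeight t := by
    refine ((integrable_gaussWeight.const_mul |u 0|).add
      integrable_id_mul_gaussWeight.abs).mono'
      (hcont.mul continuous_gaussWeight).aestronglyMeasurable (ae_of_all _ fun t => ?_)
    have := hLu t 0
    rw [sub_zero] at this
    simp only [Pi.add_apply]
    rw [norm_mul, Real.norm_of_nonneg (gaussWeight_pos t).le, abs_mul,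
      abs_of_pos (gaussWeight_pos t), ← add_mul]
    refine mul_le_mul_of_nonneg_right ?_ (gaussWeight_pos t).le
    calc ‖u t‖ = |u 0 + (u t - u 0)| := by rw [Real.norm_eq_abs]; congr 1; ring
      _ ≤ |u 0| + |u t - u 0| := abs_add_le _ _
      _ ≤ |u 0| + |t| := by gcongr
  have hpi : √(2 * Real.pi) ≠ 0 := by positivity
  have h0 : ∫ t, u t * gaussWeight t = 0 := by
    have := integral_gaussianReal_zero_one u
    rw [hu, integral_sub hig (integrable_const _)] at this
    simp only [integral_const, probReal_univ, smul_eq_mul, one_mul, ← hcdef, sub_self] at this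
    rcases mul_eq_zero.1 this.symm with h | h
    · exact absurd h (inv_ne_zero hpi)
    · exact h
  -- `u x` is the Gaussian mean of `k x - k t`, at most that of `|x - t|`; then `2 s |x - t| ≤ s² +
  -- (x - t)²` replaces Cauchy–Schwarz.
  have hub : ∀ x, |u x| ≤ √(1 + x ^ 2) := by
    intro x
    have hs2 : √(1 + x ^ 2) ^ 2 = 1 + x ^ 2 := Real.sq_sqrt (by positivity)
    set s := √(1 + x ^ 2)
    have hs : 0 < s := Real.sqrt_pos.2 (by positivity)
    obtain ⟨hq, hqv⟩ := integral_sub_sq_gaussianReal x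
    have e : u x = ∫ t, (k x - k t) ∂gaussianReal 0 1 := by
      rw [integral_sub (integrable_const _) hig]; simp [hu, hcdef]
    rw [e]
    calc |∫ t, (k x - k t) ∂gaussianReal 0 1|
        ≤ ∫ t, |k x - k t| ∂gaussianReal 0 1 := abs_integral_le_integral_abs
      _ ≤ ∫ t, (2 * s)⁻¹ * (s ^ 2 + (x - t) ^ 2) ∂gaussianReal 0 1 := by
        refine integral_mono ((integrable_const _).sub hig).abs
          (((integrable_const _).add hq).const_mul _) fun t => (hL x t).trans ?_
        rw [← sq_abs (x - t), inv_mul_eq_div, le_div_iff₀ (by positivity)]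
        nlinarith [sq_nonneg (s - |x - t|)]
      _ = s := by
        rw [integral_const_mul, integral_add (integrable_const _) hq, hqv]
        simp only [integral_const, probReal_univ, smul_eq_mul, one_mul, ← hs2]
        field_simp
        ring
  have hb := abs_steinSol_le_one hi h0 hLu
  have hd := hasDerivAt_steinSol hcont hi
  refine ⟨steinSol u, fun x => x * steinSol u x + u x, hd, fun x => (hb x).1,
    abs_deriv_steinSol_le hi h0 hLu hub, fun x y => ?_, fun x => by simp [hu]⟩
  have hp : ∀ x, HasDerivAt (fun y => y * steinSol u y)
      (steinSol u x * (1 + x ^ 2) + x * u x) x := fun x =>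
    ((hasDerivAt_id x).mul (hd x)).congr_deriv (by simp only [id]; ring)
  have hpl : |x * steinSol u x - y * steinSol u y| ≤ 1 * |x - y| := by
    simpa only [Real.norm_eq_abs] using Convex.norm_image_sub_le_of_norm_hasDerivWithin_le
      (f := fun y => y * steinSol u y) (s := univ) (C := 1) (fun z _ => (hp z).hasDerivWithinAt)
      (fun z _ => (hb z).2) convex_univ (mem_univ y) (mem_univ x)
  calc _ = |(x * steinSol u x - y * steinSol u y) + (u x - u y)| := by congr 1; ring
    _ ≤ _ := abs_add_le _ _
    _ ≤ 1 * |x - y| + |x - y| := add_le_add hpl (hLu x y)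
    _ = _ := by ring

/-- Solution of the Stein equation for the Gaussian law of variance `σ ^ 2`, with bounds. -/
lemma exists_stein {h : ℝ → ℝ} (hL : ∀ x y, |h x - h y| ≤ |x - y|) {σ : ℝ} (hσ : 0 < σ) :
    ∃ A A' : ℝ → ℝ, (∀ x, HasDerivAt A (A' x) x) ∧ (∀ x, |A x| ≤ 1) ∧
      (∀ x, |A' x| ≤ 11 / 8 * σ⁻¹) ∧
      (∀ x y, |A' x - A' y| ≤ 2 * (σ ^ 2)⁻¹ * |x - y|) ∧
      ∀ x, σ ^ 2 * A' x - x * A x =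
        h x - ∫ t, h t ∂gaussianReal 0 (Real.toNNReal (σ ^ 2)) := by
  have hc : Continuous h := continuous_of_abs_sub_le (c := 1) (by simpa using hL)
  obtain ⟨F, F', hd, hF, hF', hFL, heq⟩ :=
    -- This rescaling keeps the Lipschitz constant 1; then `A x = F (x / σ)` gains one factor `σ⁻¹`
    -- per derivative and none in the bound on `A` itself.
    exists_stein_standard (k := fun x => σ⁻¹ * h (σ * x)) fun x y => by
      rw [← mul_sub, abs_mul, abs_of_pos (inv_pos.2 hσ), inv_mul_le_iff₀ hσ]
      refine (hL _ _).trans_eq ?_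
      rw [← mul_sub, abs_mul, abs_of_pos hσ]
  have hmap : ∫ t, h t ∂gaussianReal 0 (Real.toNNReal (σ ^ 2)) =
      ∫ t, h (σ * t) ∂gaussianReal 0 1 := by
    have e := gaussianReal_map_const_mul (μ := 0) (v := 1) σ
    rw [mul_zero, mul_one] at e
    have e2 : Real.toNNReal (σ ^ 2) = NNReal.mk (σ ^ 2) (sq_nonneg σ) := Real.toNNReal_of_nonneg _
    rw [e2, ← e, integral_map (by fun_prop) hc.aestronglyMeasurable]
  refine ⟨fun x => F (σ⁻¹ * x), fun x => F' (σ⁻¹ * x) * σ⁻¹, fun x => ?_, fun x => hF _,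
    fun x => ?_, fun x y => ?_, fun x => ?_⟩
  · have h1 : HasDerivAt (fun x => σ⁻¹ * x) σ⁻¹ x := by
      simpa using (hasDerivAt_id x).const_mul σ⁻¹
    exact HasDerivAt.comp x (hd (σ⁻¹ * x)) h1
  · rw [abs_mul, abs_of_pos (inv_pos.2 hσ)]
    exact mul_le_mul_of_nonneg_right (hF' _) (inv_pos.2 hσ).le
  · rw [← sub_mul, abs_mul, abs_of_pos (inv_pos.2 hσ)]
    have := hFL (σ⁻¹ * x) (σ⁻¹ * y)
    rw [← mul_sub, abs_mul, abs_of_pos (inv_pos.2 hσ)] at this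
    refine (mul_le_mul_of_nonneg_right this (inv_pos.2 hσ).le).trans_eq ?_
    rw [← inv_pow]; ring
  · have := heq (σ⁻¹ * x)
    rw [integral_const_mul, mul_inv_cancel_left₀ hσ.ne', ← hmap] at this
    have h2 := congrArg (σ * ·) this
    simp only [mul_sub] at h2
    rw [mul_inv_cancel_left₀ hσ.ne', mul_inv_cancel_left₀ hσ.ne'] at h2
    rw [← h2]
    field_simp

/-! ### From bounds on the Stein solution to test functions and Taylor remainders. -/

lemma isAbsCont_of_lipschitz {g : ℝ → ℝ} {c : ℝ} (hL : ∀ x y, |g x - g y| ≤ c * |x - y|) :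
    IsAbsCont g := by
  have hLip : LipschitzWith c.toNNReal g := LipschitzWith.of_dist_le' (K := c) fun x y => by
    simpa only [Real.dist_eq] using hL x y
  refine ⟨hLip.ae_differentiableAt_real, ?_, fun x y _ => ?_⟩
  · refine (locallyIntegrable_const (c.toNNReal : ℝ)).mono
      (measurable_deriv g).aestronglyMeasurable (ae_of_all _ fun x => ?_)
    exact (norm_deriv_le_of_lipschitz hLip).trans (le_abs_self _)
  · rw [(hLip.lipschitzOnWith.absolutelyContinuousOnInterval (a := x) (b := y)).integral_deriv_eq_sub]
    ring

/-- A function with the bounds of the Stein solution is, up to scaling, a test function. -/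
lemma isTestFun_of_bounds {A A' : ℝ → ℝ} {c : ℝ} (hd : ∀ x, HasDerivAt A (A' x) x) (hc : 0 < c)
    (h0 : ∀ x, |A x| ≤ c) (h1 : ∀ x, |A' x| ≤ c) (h2 : ∀ x y, |A' x - A' y| ≤ c * |x - y|) :
    IsTestFun fun x => c⁻¹ * A x := by
  have hderiv : deriv (fun x => c⁻¹ * A x) = fun x => c⁻¹ * A' x :=
    funext fun x => ((hd x).const_mul _).deriv
  have hL : ∀ x y, |c⁻¹ * A' x - c⁻¹ * A' y| ≤ 1 * |x - y| := fun x y => by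
    rw [← mul_sub, abs_mul, abs_of_pos (inv_pos.2 hc), inv_mul_le_iff₀ hc, one_mul]
    exact h2 x y
  have hLip : LipschitzWith (1 : ℝ).toNNReal fun x => c⁻¹ * A' x :=
    LipschitzWith.of_dist_le' (K := 1) fun x y => by simpa only [Real.dist_eq] using hL x y
  refine ⟨fun x => ((hd x).const_mul _).differentiableAt, ?_, fun x => ?_, fun x => ?_,
    ae_of_all _ fun x => ?_⟩
  · rw [hderiv]; exact isAbsCont_of_lipschitz hL
  · rw [abs_mul, abs_of_pos (inv_pos.2 hc), inv_mul_le_iff₀ hc, mul_one]; exact h0 x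
  · rw [hderiv, abs_mul, abs_of_pos (inv_pos.2 hc), inv_mul_le_iff₀ hc, mul_one]; exact h1 x
  · rw [hderiv]
    -- This holds at every point, since `deriv` is 0 where the function is not differentiable.
    simpa using norm_deriv_le_of_lipschitz (x₀ := x) hLip

/-- First-order Taylor estimate for a function with Lipschitz derivative. -/
lemma abs_taylor_le {A A' : ℝ → ℝ} {c : ℝ} (hd : ∀ x, HasDerivAt A (A' x) x)
    (h2 : ∀ x y, |A' x - A' y| ≤ 2 * c * |x - y|) (w v : ℝ) :
    |A w - A v - A' w * (w - v)| ≤ c * (w - v) ^ 2 := by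
  have hcont : Continuous A' := continuous_of_abs_sub_le h2
  have hint : ∀ a b, ∫ t in a..b, A' t = A b - A a := fun a b =>
    intervalIntegral.integral_eq_sub_of_hasDerivAt (fun t _ => hd t)
      (hcont.intervalIntegrable _ _)
  have e : A w - A v - A' w * (w - v) = ∫ s in (0 : ℝ)..1, (A' (v + s * (w - v)) - A' w) * (w - v) := by
    have hd1 : ∀ s, HasDerivAt (fun s => A (v + s * (w - v)) - A' w * (w - v) * s)
        ((A' (v + s * (w - v)) - A' w) * (w - v)) s := fun s => by
      have h1 : HasDerivAt (fun s => v + s * (w - v)) (w - v) s := by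
        simpa using ((hasDerivAt_id s).mul_const (w - v)).const_add v
      have h3 := ((hd (v + s * (w - v))).comp s h1).sub
        ((hasDerivAt_id s).const_mul (A' w * (w - v)))
      exact h3.congr_deriv (by ring)
    rw [intervalIntegral.integral_eq_sub_of_hasDerivAt (fun s _ => hd1 s)
      (Continuous.intervalIntegrable (by fun_prop) _ _)]
    simp
    ring
  have e2 : c * (w - v) ^ 2 = ∫ s in (0 : ℝ)..1, 2 * c * (w - v) ^ 2 * (1 - s) := by
    rw [intervalIntegral.integral_const_mul, intervalIntegral.integral_sub (by simp) (by simp)]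
    simp
    ring
  rw [e, e2, ← Real.norm_eq_abs]
  refine intervalIntegral.norm_integral_le_of_norm_le zero_le_one ?_
    (Continuous.intervalIntegrable (by fun_prop) _ _)
  refine ae_of_all _ fun s hs => ?_
  rw [norm_mul, Real.norm_eq_abs, Real.norm_eq_abs]
  calc _ ≤ 2 * c * |v + s * (w - v) - w| * |w - v| :=
        mul_le_mul_of_nonneg_right (h2 _ _) (abs_nonneg _)
    _ = 2 * c * (|1 - s| * |w - v|) * |w - v| := by
        rw [← abs_mul, ← abs_neg ((1 - s) * (w - v))]; congr 3; ring
    _ = _ := by rw [abs_of_nonneg (sub_nonneg.2 hs.2), ← sq_abs (w - v)]; ring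

/-! ### Windows and tail sums -/

lemma mem_window {N K n k : ℕ} : k ∈ window N K n ↔ k < N ∧ k ≤ n + K ∧ n ≤ k + K := by
  simp only [window, Finset.mem_filter, Finset.mem_range, abs_le]
  omega

lemma card_window_le (N K n : ℕ) : ((window N K n).card : ℝ) ≤ 2 * (K + 1) := by
  have h : window N K n ⊆ Finset.Icc (n - K) (n + K) := fun k hk => by
    rw [mem_window] at hk; rw [Finset.mem_Icc]; omega
  have h2 := Finset.card_le_card h
  rw [Nat.card_Icc] at h2
  have : (window N K n).card ≤ 2 * (K + 1) := by omega
  exact_mod_cast this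

lemma sum_window_comm (N K : ℕ) (g : ℕ → ℕ → ℝ) :
    ∑ n ∈ Finset.range N, ∑ k ∈ window N K n, g n k =
      ∑ k ∈ Finset.range N, ∑ n ∈ window N K k, g n k := by
  refine Finset.sum_comm' fun n k => ?_
  simp only [mem_window, Finset.mem_range]
  omega

/-- The tail sums of a sequence. -/
noncomputable def tailSum (ρ : ℕ → ℝ) (m : ℕ) : ℝ := ∑' i, ρ (m + i)

section Tail

variable {ρ : ℕ → ℝ}

lemma summable_shift (hs : Summable ρ) (m : ℕ) : Summable fun i => ρ (m + i) := by
  simpa only [add_comm] using (summable_nat_add_iff m).2 hs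

lemma tailSum_nonneg (h0 : ∀ i, 0 ≤ ρ i) (m : ℕ) : 0 ≤ tailSum ρ m := tsum_nonneg fun _ => h0 _

/-- Summing tails counts `ρ i` exactly `min i N` times. This is where the first moment of `ρ`
enters. -/
lemma sum_tailSum_le (h0 : ∀ i, 0 ≤ ρ i) (hs : Summable ρ)
    (hsum : Summable fun i : ℕ => (i : ℝ) * ρ i) (N : ℕ) :
    ∑ n ∈ Finset.range N, tailSum ρ (n + 1) ≤ ∑' i : ℕ, (i : ℝ) * ρ i := by
  have key : ∀ N : ℕ, ∑ n ∈ Finset.range N, tailSum ρ (n + 1) =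
      ∑ i ∈ Finset.range (N + 1), (i : ℝ) * ρ i + N * tailSum ρ (N + 1) := by
    intro N
    induction N with
    | zero => simp
    | succ N ih =>
      have e : tailSum ρ (N + 1) = ρ (N + 1) + tailSum ρ (N + 1 + 1) := by
        rw [tailSum, (summable_shift hs (N + 1)).tsum_eq_zero_add, add_zero, tailSum]
        congr 2
        funext i
        congr 1
        ring
      rw [Finset.sum_range_succ, ih, Finset.sum_range_succ _ (N + 1), e]
      push_cast
      ring
  rw [key, ← hsum.sum_add_tsum_nat_add (N + 1), tailSum, ← tsum_mul_left]
  refine add_le_add le_rfl (Summable.tsum_le_tsum (fun i => ?_)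
    ((summable_shift hs _).mul_left _) ((summable_nat_add_iff (N + 1)).2 hsum))
  rw [add_comm (N + 1) i]
  refine mul_le_mul_of_nonneg_right ?_ (h0 _)
  push_cast
  have : (0 : ℝ) ≤ i := Nat.cast_nonneg i
  linarith

/-- On either side of `n` each distance occurs at most once. -/
lemma sum_dist_le (h0 : ∀ i, 0 ≤ ρ i) (hs : Summable ρ) (s : Finset ℕ) (n : ℕ) :
    ∑ m ∈ s, ρ (Nat.dist m n) ≤ 2 * ∑' i, ρ i := by
  have h1 : ∑ m ∈ s with n ≤ m, ρ (Nat.dist m n) ≤ ∑' i, ρ i := by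
    rw [← Finset.sum_image (f := ρ) (g := fun m => Nat.dist m n)]
    · exact hs.sum_le_tsum _ fun i _ => h0 i
    · intro a ha b hb hab
      simp only [Finset.coe_filter, mem_ofPred_eq, Nat.dist] at ha hb hab
      omega
  have h2 : ∑ m ∈ s with ¬ n ≤ m, ρ (Nat.dist m n) ≤ ∑' i, ρ i := by
    rw [← Finset.sum_image (f := ρ) (g := fun m => Nat.dist m n)]
    · exact hs.sum_le_tsum _ fun i _ => h0 i
    · intro a ha b hb hab
      simp only [Finset.coe_filter, mem_ofPred_eq, Nat.dist] at ha hb hab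
      omega
  rw [← Finset.sum_filter_add_sum_filter_not s (n ≤ ·)]
  linarith

end Tail

/-- The window has a left and a right arm, each cut either at length `K` or at the end of `[0, N)`;
the minima record which. -/
lemma sum_window_dist (c : ℕ → ℝ) {N K n : ℕ} (hn : n < N) :
    ∑ k ∈ window N K n, c (Nat.dist n k) =
      c 0 + ∑ i ∈ Finset.range (min K n), c (i + 1) +
        ∑ i ∈ Finset.range (min K (N - 1 - n)), c (i + 1) := by
  set a := min K n with ha
  set b := min K (N - 1 - n) with hb
  have e : window N K n = Finset.Ico (n - a) n ∪ Finset.Ico n (n + (b + 1)) := by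
    ext k
    rw [mem_window, Finset.mem_union, Finset.mem_Ico, Finset.mem_Ico]
    omega
  have hd : Disjoint (Finset.Ico (n - a) n) (Finset.Ico n (n + (b + 1))) :=
    Finset.Ico_disjoint_Ico_consecutive _ _ _
  have h1 : ∑ k ∈ Finset.Ico (n - a) n, c (Nat.dist n k) =
      ∑ i ∈ Finset.range a, c (i + 1) := by
    rw [Finset.sum_Ico_eq_sum_range, ← Finset.sum_range_reflect,
      show n - (n - a) = a by omega]
    refine Finset.sum_congr rfl fun i hi => ?_
    rw [Finset.mem_range] at hi
    congr 1
    simp only [Nat.dist]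
    omega
  have h2 : ∑ k ∈ Finset.Ico n (n + (b + 1)), c (Nat.dist n k) =
      c 0 + ∑ i ∈ Finset.range b, c (i + 1) := by
    rw [Finset.sum_Ico_eq_sum_range, show n + (b + 1) - n = b + 1 by omega,
      Finset.sum_range_succ']
    rw [add_comm]
    congr 1
    · simp [Nat.dist]
    · refine Finset.sum_congr rfl fun i _ => ?_
      congr 1
      simp only [Nat.dist]
      omega
  rw [e, Finset.sum_union hd, h1, h2]
  ring

/-! ### Covariance estimates for mixing processes -/

/-- A bounded process with stationary covariances `c` and the decay of correlations of orders two
and four (the latter up to time `N`) at rate `ρ`. -/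
structure IsMixingProcess {X : Type*} [MeasurableSpace X] (μ : Measure X) (ξ : ℕ → X → ℝ)
    (c ρ : ℕ → ℝ) (C₂ C₄ : ℝ) (N : ℕ) : Prop where
  meas : ∀ n, Measurable (ξ n)
  bdd : ∃ M, ∀ n x, |ξ n x| ≤ M
  cov : ∀ i j, ∫ x, ξ i x * ξ j x ∂μ = c (Nat.dist i j)
  cov_le : ∀ k, |c k| ≤ C₂ * ρ k
  fourth_left : ∀ i j k l, i ≤ j → j ≤ k → k ≤ l → l < N →
    |∫ x, ξ i x * ξ j x * (ξ k x * ξ l x) ∂μ| ≤ C₄ * ρ (j - i)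
  fourth_mid : ∀ i j k l, i ≤ j → j ≤ k → k ≤ l → l < N →
    |(∫ x, ξ i x * ξ j x * (ξ k x * ξ l x) ∂μ) - c (Nat.dist i j) * c (Nat.dist k l)| ≤
      C₄ * ρ (k - j)
  nonneg : ∀ i, 0 ≤ ρ i
  anti : Antitone ρ
  zero : ρ 0 = 1
  summable : Summable ρ
  C₂_pos : 0 < C₂
  C₄_pos : 0 < C₄

namespace IsMixingProcess

variable {X : Type*} [MeasurableSpace X] {μ : Measure X}
  {ξ : ℕ → X → ℝ} {c ρ : ℕ → ℝ} {C₂ C₄ : ℝ} {N : ℕ}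

lemma summable_cov (h : IsMixingProcess μ ξ c ρ C₂ C₄ N) : Summable fun n => c (n + 1) :=
  Summable.of_norm_bounded (((summable_nat_add_iff 1).2 h.summable).mul_left C₂)
    fun n => h.cov_le (n + 1)

lemma abs_tsum_sub_sum_le (h : IsMixingProcess μ ξ c ρ C₂ C₄ N) (p : ℕ) :
    |(∑' n, c (n + 1)) - ∑ i ∈ Finset.range p, c (i + 1)| ≤ C₂ * tailSum ρ (p + 1) := by
  rw [← h.summable_cov.sum_add_tsum_nat_add p, add_sub_cancel_left, tailSum, ← tsum_mul_left,
    ← Real.norm_eq_abs]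
  refine tsum_of_norm_bounded ((summable_shift h.summable (p + 1)).mul_left C₂).hasSum
    fun i => ?_
  refine (h.cov_le _).trans_eq ?_
  congr 2
  ring

lemma integrable_mul [IsProbabilityMeasure μ]
    (h : IsMixingProcess μ ξ c ρ C₂ C₄ N) (i j : ℕ) :
    Integrable (fun x => ξ i x * ξ j x) μ := by
  obtain ⟨M, hM⟩ := h.bdd
  refine Integrable.of_bound ((h.meas i).mul (h.meas j)).aestronglyMeasurable (M * M)
    (ae_of_all _ fun x => ?_)
  rw [norm_mul]
  exact mul_le_mul (hM i x) (hM j x) (abs_nonneg _) ((abs_nonneg _).trans (hM i x))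

lemma integrable_mul_mul [IsProbabilityMeasure μ]
    (h : IsMixingProcess μ ξ c ρ C₂ C₄ N) (i j k l : ℕ) :
    Integrable (fun x => ξ i x * ξ j x * (ξ k x * ξ l x)) μ := by
  obtain ⟨M, hM⟩ := h.bdd
  refine (h.integrable_mul k l).bdd_mul (c := M * M)
    ((h.meas i).mul (h.meas j)).aestronglyMeasurable (ae_of_all _ fun x => ?_)
  rw [norm_mul]
  exact mul_le_mul (hM i x) (hM j x) (abs_nonneg _) ((abs_nonneg _).trans (hM i x))

/-- The limit variance is `c 0` plus two one-sided series, one per arm of the window; only their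
tails are missing. -/
lemma abs_cov_window_sub_le (h : IsMixingProcess μ ξ c ρ C₂ C₄ N) {L K n : ℕ} (hn : n < L) :
    |(c 0 + 2 * ∑' i, c (i + 1)) - ∑ k ∈ window L K n, c (Nat.dist n k)| ≤
      C₂ * (tailSum ρ (min K n + 1) + tailSum ρ (min K (L - 1 - n) + 1)) := by
  rw [sum_window_dist c hn]
  have h1 := abs_le.1 (h.abs_tsum_sub_sum_le (min K n))
  have h2 := abs_le.1 (h.abs_tsum_sub_sum_le (min K (L - 1 - n)))
  rw [abs_le]
  constructor <;> linarith [h1.1, h1.2, h2.1, h2.2]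

/-- Separates the loss due to the gap, the same for every `n`, from the boundary loss, which is
summable in `n`. -/
lemma tailSum_min_le (h : IsMixingProcess μ ξ c ρ C₂ C₄ N) (a b : ℕ) :
    tailSum ρ (min a b + 1) ≤ tailSum ρ (a + 1) + tailSum ρ (b + 1) := by
  rcases min_choice a b with e | e <;> rw [e] <;>
    linarith [tailSum_nonneg h.nonneg (a + 1), tailSum_nonneg h.nonneg (b + 1)]

lemma sum_tailSum_reflect_le (h : IsMixingProcess μ ξ c ρ C₂ C₄ N)
    (hsum : Summable fun i : ℕ => (i : ℝ) * ρ i) (L : ℕ) :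
    ∑ n ∈ Finset.range L, tailSum ρ (L - 1 - n + 1) ≤ ∑' i : ℕ, (i : ℝ) * ρ i := by
  rw [Finset.sum_range_reflect (fun n => tailSum ρ (n + 1)) L]
  exact sum_tailSum_le h.nonneg h.summable hsum L

/-- The mean of the windowed quadratic sums is close to the limit variance. -/
lemma abs_variance_sub_window_le (h : IsMixingProcess μ ξ c ρ C₂ C₄ N)
    (hsum : Summable fun i : ℕ => (i : ℝ) * ρ i) (L K : ℕ) :
    |L * (c 0 + 2 * ∑' i, c (i + 1)) -
        ∑ n ∈ Finset.range L, ∑ k ∈ window L K n, c (Nat.dist n k)| ≤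
      2 * C₂ * (L * tailSum ρ (K + 1) + ∑' i : ℕ, (i : ℝ) * ρ i) := by
  have e : L * (c 0 + 2 * ∑' i, c (i + 1)) -
        ∑ n ∈ Finset.range L, ∑ k ∈ window L K n, c (Nat.dist n k) =
      ∑ n ∈ Finset.range L, ((c 0 + 2 * ∑' i, c (i + 1)) -
        ∑ k ∈ window L K n, c (Nat.dist n k)) := by
    rw [Finset.sum_sub_distrib, Finset.sum_const, Finset.card_range, nsmul_eq_mul]
  rw [e]
  calc _ ≤ ∑ n ∈ Finset.range L, C₂ * ((tailSum ρ (K + 1) + tailSum ρ (n + 1)) +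
        (tailSum ρ (K + 1) + tailSum ρ (L - 1 - n + 1))) := by
        refine (Finset.abs_sum_le_sum_abs _ _).trans (Finset.sum_le_sum fun n hn => ?_)
        refine (h.abs_cov_window_sub_le (Finset.mem_range.1 hn)).trans ?_
        exact mul_le_mul_of_nonneg_left (add_le_add (h.tailSum_min_le _ _)
          (h.tailSum_min_le _ _)) h.C₂_pos.le
    _ = C₂ * ((L * tailSum ρ (K + 1) + ∑ n ∈ Finset.range L, tailSum ρ (n + 1)) +
        (L * tailSum ρ (K + 1) + ∑ n ∈ Finset.range L, tailSum ρ (L - 1 - n + 1))) := by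
        rw [← Finset.mul_sum]
        simp only [Finset.sum_add_distrib, Finset.sum_const, Finset.card_range, nsmul_eq_mul]
    _ ≤ C₂ * ((L * tailSum ρ (K + 1) + ∑' i : ℕ, (i : ℝ) * ρ i) +
        (L * tailSum ρ (K + 1) + ∑' i : ℕ, (i : ℝ) * ρ i)) := by
        refine mul_le_mul_of_nonneg_left (add_le_add (add_le_add le_rfl ?_)
          (add_le_add le_rfl ?_)) h.C₂_pos.le
        · exact sum_tailSum_le h.nonneg h.summable hsum L
        · exact h.sum_tailSum_reflect_le hsum L
    _ = _ := by ring

lemma integral_sq_sum [IsProbabilityMeasure μ]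
    (h : IsMixingProcess μ ξ c ρ C₂ C₄ N) (s : Finset ℕ) :
    ∫ x, (∑ k ∈ s, ξ k x) ^ 2 ∂μ = ∑ k ∈ s, ∑ l ∈ s, c (Nat.dist k l) := by
  simp only [sq, Finset.sum_mul_sum]
  rw [integral_finsetSum _ fun k _ => integrable_finsetSum _ fun l _ => h.integrable_mul k l]
  refine Finset.sum_congr rfl fun k _ => ?_
  rw [integral_finsetSum _ fun l _ => h.integrable_mul k l]
  exact Finset.sum_congr rfl fun l _ => h.cov k l

lemma integral_sq_sum_le [IsProbabilityMeasure μ]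
    (h : IsMixingProcess μ ξ c ρ C₂ C₄ N) (s : Finset ℕ) :
    ∫ x, (∑ k ∈ s, ξ k x) ^ 2 ∂μ ≤ s.card * (2 * C₂ * ∑' i, ρ i) := by
  rw [h.integral_sq_sum]
  refine (Finset.sum_le_card_nsmul s _ (2 * C₂ * ∑' i, ρ i) fun k _ => ?_).trans_eq
    (nsmul_eq_mul _ _)
  calc _ ≤ ∑ l ∈ s, C₂ * ρ (Nat.dist l k) := Finset.sum_le_sum fun l _ => by
        rw [Nat.dist_comm l k]; exact (le_abs_self _).trans (h.cov_le _)
    _ ≤ _ := by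
        rw [← Finset.mul_sum]
        have := mul_le_mul_of_nonneg_left (sum_dist_le h.nonneg h.summable s k) h.C₂_pos.le
        linarith

/-- If `j ≤ k` the pairs are separated and the middle gap decorrelates them. If they interleave, the
fourth moment and the product of covariances are each small on their own, through the first gap `k -
i`, which is at most `j - i`. -/
lemma abs_cov_pair_le_aux (h : IsMixingProcess μ ξ c ρ C₂ C₄ N) {C : ℝ} (hC2 : C₂ ^ 2 ≤ C)
    (hC4 : C₄ ≤ C) {i j k l : ℕ} (hij : i ≤ j) (hkl : k ≤ l) (hik : i ≤ k) (hj : j < N)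
    (hl : l < N) :
    |(∫ x, ξ i x * ξ j x * (ξ k x * ξ l x) ∂μ) - c (Nat.dist i j) * c (Nat.dist k l)| ≤
      2 * C * (ρ (Nat.dist k i) + ρ (Nat.dist k j)) := by
  have hC : 0 ≤ C := (sq_nonneg _).trans hC2
  have hρ1 : ∀ n, ρ n ≤ 1 := fun n => h.zero ▸ h.anti (Nat.zero_le n)
  rcases le_total j k with hjk | hkj
  · refine (h.fourth_mid i j k l hij hjk hkl hl).trans ?_
    have e : Nat.dist k j = k - j := by simp only [Nat.dist]; omega
    rw [e]
    nlinarith [mul_le_mul_of_nonneg_right hC4 (h.nonneg (k - j)),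
      mul_nonneg hC (h.nonneg (k - j)), mul_nonneg hC (h.nonneg (Nat.dist k i))]
  · have e : Nat.dist k i = k - i := by simp only [Nat.dist]; omega
    have h4 : |∫ x, ξ i x * ξ j x * (ξ k x * ξ l x) ∂μ| ≤ C₄ * ρ (k - i) := by
      rcases le_total j l with hjl | hlj
      · have := h.fourth_left i k j l hik hkj hjl hl
        convert this using 4
        ring
      · have := h.fourth_left i k l j hik hkl hlj hj
        convert this using 4
        ring
    have h2 : |c (Nat.dist i j) * c (Nat.dist k l)| ≤ C₂ ^ 2 * ρ (k - i) := by
      rw [abs_mul]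
      have h5 : |c (Nat.dist i j)| ≤ C₂ * ρ (k - i) := (h.cov_le _).trans
        (mul_le_mul_of_nonneg_left (h.anti (by simp only [Nat.dist]; omega)) h.C₂_pos.le)
      have h6 : |c (Nat.dist k l)| ≤ C₂ * 1 := (h.cov_le _).trans
        (mul_le_mul_of_nonneg_left (hρ1 _) h.C₂_pos.le)
      refine (mul_le_mul h5 h6 (abs_nonneg _) ?_).trans_eq (by ring)
      exact mul_nonneg h.C₂_pos.le (h.nonneg _)
    refine (abs_sub _ _).trans ?_
    rw [e]
    nlinarith [mul_le_mul_of_nonneg_right hC4 (h.nonneg (k - i)),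
      mul_le_mul_of_nonneg_right hC2 (h.nonneg (k - i)),
      mul_nonneg hC (h.nonneg (Nat.dist k j))]

/-- Covariances of products of two variables of the process. -/
lemma abs_cov_pair_le (h : IsMixingProcess μ ξ c ρ C₂ C₄ N) {C : ℝ} (hC2 : C₂ ^ 2 ≤ C)
    (hC4 : C₄ ≤ C) {i j k l : ℕ} (hi : i < N) (hj : j < N) (hk : k < N) (hl : l < N) :
    |(∫ x, ξ i x * ξ j x * (ξ k x * ξ l x) ∂μ) - c (Nat.dist i j) * c (Nat.dist k l)| ≤
      2 * C * (ρ (Nat.dist k i) + ρ (Nat.dist k j) + ρ (Nat.dist l i) + ρ (Nat.dist l j)) := by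
  have hC : 0 ≤ C := (sq_nonneg _).trans hC2
  -- All four cross distances appear on the right so that the bound is invariant under swaps within
  -- a pair and of the two pairs; the sorted case then suffices.
  have sorted : ∀ {i j k l : ℕ}, i ≤ j → k ≤ l → i < N → j < N → k < N → l < N →
      |(∫ x, ξ i x * ξ j x * (ξ k x * ξ l x) ∂μ) - c (Nat.dist i j) * c (Nat.dist k l)| ≤
        2 * C * (ρ (Nat.dist k i) + ρ (Nat.dist k j) + ρ (Nat.dist l i) + ρ (Nat.dist l j)) := by
    intro i j k l hij hkl hi hj hk hl
    have p1 := mul_nonneg hC (h.nonneg (Nat.dist k i))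
    have p2 := mul_nonneg hC (h.nonneg (Nat.dist k j))
    have p3 := mul_nonneg hC (h.nonneg (Nat.dist l i))
    have p4 := mul_nonneg hC (h.nonneg (Nat.dist l j))
    rcases le_total i k with hik | hki
    · have := h.abs_cov_pair_le_aux hC2 hC4 hij hkl hik hj hl
      linarith
    · have := h.abs_cov_pair_le_aux hC2 hC4 hkl hij hki hl hj
      rw [Nat.dist_comm i k, Nat.dist_comm i l, mul_comm (c (Nat.dist k l))] at this
      simp only [mul_comm (ξ k _ * ξ l _)] at this
      linarith
  have half : ∀ {i j k l : ℕ}, i ≤ j → i < N → j < N → k < N → l < N →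
      |(∫ x, ξ i x * ξ j x * (ξ k x * ξ l x) ∂μ) - c (Nat.dist i j) * c (Nat.dist k l)| ≤
        2 * C * (ρ (Nat.dist k i) + ρ (Nat.dist k j) + ρ (Nat.dist l i) + ρ (Nat.dist l j)) := by
    intro i j k l hij hi hj hk hl
    rcases le_total k l with hkl | hlk
    · exact sorted hij hkl hi hj hk hl
    · have := sorted hij hlk hi hj hl hk
      rw [Nat.dist_comm l k] at this
      simp only [mul_comm (ξ l _) (ξ k _)] at this
      linarith
  rcases le_total i j with hij | hji
  · exact half hij hi hj hk hl
  · have := half hji hj hi hk hl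
    rw [Nat.dist_comm j i] at this
    simp only [mul_comm (ξ j _) (ξ i _)] at this
    linarith

/-- There are `N` choices of `n`, at most `2(K+1)` each of `k` and `l`, and the sum over `m` costs
`2 ∑ ρ`. -/
lemma sum_window_sum_window_dist_le (h : IsMixingProcess μ ξ c ρ C₂ C₄ N) (K : ℕ) :
    ∑ n ∈ Finset.range N, ∑ _k ∈ window N K n, ∑ m ∈ Finset.range N, ∑ _l ∈ window N K m,
      ρ (Nat.dist m n) ≤ 8 * (∑' i, ρ i) * N * ((K : ℝ) + 1) ^ 2 := by
  have hb : 0 ≤ ∑' i, ρ i := tsum_nonneg h.nonneg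
  have h1 : ∀ n, ∑ m ∈ Finset.range N, ∑ _l ∈ window N K m, ρ (Nat.dist m n) ≤
      2 * (K + 1) * (2 * ∑' i, ρ i) := by
    intro n
    calc _ ≤ ∑ m ∈ Finset.range N, 2 * ((K : ℝ) + 1) * ρ (Nat.dist m n) := by
          refine Finset.sum_le_sum fun m _ => ?_
          rw [Finset.sum_const, nsmul_eq_mul]
          exact mul_le_mul_of_nonneg_right (card_window_le _ _ _) (h.nonneg _)
      _ ≤ _ := by
          rw [← Finset.mul_sum]
          exact mul_le_mul_of_nonneg_left (sum_dist_le h.nonneg h.summable _ _) (by positivity)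
  calc _ ≤ ∑ n ∈ Finset.range N, ∑ _k ∈ window N K n, 2 * ((K : ℝ) + 1) * (2 * ∑' i, ρ i) :=
        Finset.sum_le_sum fun n _ => Finset.sum_le_sum fun k _ => h1 n
    _ ≤ ∑ n ∈ Finset.range N, 2 * ((K : ℝ) + 1) * (2 * ((K : ℝ) + 1) * (2 * ∑' i, ρ i)) := by
        refine Finset.sum_le_sum fun n _ => ?_
        rw [Finset.sum_const, nsmul_eq_mul]
        refine mul_le_mul_of_nonneg_right (card_window_le _ _ _) ?_
        positivity
    _ = _ := by
        rw [Finset.sum_const, Finset.card_range, nsmul_eq_mul]; ring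

/-- The variance of the windowed quadratic sums. -/
lemma integral_sq_window_le [IsProbabilityMeasure μ]
    (h : IsMixingProcess μ ξ c ρ C₂ C₄ N) {C : ℝ} (hC2 : C₂ ^ 2 ≤ C)
    (hC4 : C₄ ≤ C) (K : ℕ) :
    ∫ x, (∑ n ∈ Finset.range N, ∑ k ∈ window N K n,
      (ξ n x * ξ k x - c (Nat.dist n k))) ^ 2 ∂μ ≤
      64 * C * (∑' i, ρ i) * N * ((K : ℝ) + 1) ^ 2 := by
  have hC : 0 ≤ C := (sq_nonneg _).trans hC2
  have hi1 : ∀ i j, Integrable (fun x => ξ i x * ξ j x - c (Nat.dist i j)) μ := fun i j =>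
    (h.integrable_mul i j).sub (integrable_const _)
  have hexp : ∀ i j k l, (fun x => (ξ i x * ξ j x - c (Nat.dist i j)) *
      (ξ k x * ξ l x - c (Nat.dist k l))) = fun x => ξ i x * ξ j x * (ξ k x * ξ l x) -
        c (Nat.dist i j) * (ξ k x * ξ l x) - c (Nat.dist k l) *
          (ξ i x * ξ j x - c (Nat.dist i j)) := fun i j k l => by
    funext x; ring
  have hi3 : ∀ i j k l, Integrable (fun x => ξ i x * ξ j x * (ξ k x * ξ l x) -
      c (Nat.dist i j) * (ξ k x * ξ l x)) μ := fun i j k l =>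
    (h.integrable_mul_mul i j k l).sub ((h.integrable_mul k l).const_mul _)
  have hi2 : ∀ i j k l, Integrable (fun x => (ξ i x * ξ j x - c (Nat.dist i j)) *
      (ξ k x * ξ l x - c (Nat.dist k l))) μ := fun i j k l => by
    rw [hexp]
    exact (hi3 i j k l).sub ((hi1 i j).const_mul _)
  have hval : ∀ i j k l, ∫ x, (ξ i x * ξ j x - c (Nat.dist i j)) *
      (ξ k x * ξ l x - c (Nat.dist k l)) ∂μ =
        (∫ x, ξ i x * ξ j x * (ξ k x * ξ l x) ∂μ) - c (Nat.dist i j) * c (Nat.dist k l) := by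
    intro i j k l
    rw [hexp, integral_sub (hi3 i j k l) ((hi1 i j).const_mul _),
      integral_sub (h.integrable_mul_mul i j k l) ((h.integrable_mul k l).const_mul _),
      integral_const_mul, integral_const_mul, integral_sub (h.integrable_mul i j)
      (integrable_const _), h.cov, h.cov]
    simp
  have hsq : ∫ x, (∑ n ∈ Finset.range N, ∑ k ∈ window N K n,
      (ξ n x * ξ k x - c (Nat.dist n k))) ^ 2 ∂μ =
      ∑ n ∈ Finset.range N, ∑ k ∈ window N K n, ∑ m ∈ Finset.range N, ∑ l ∈ window N K m,
        ((∫ x, ξ n x * ξ k x * (ξ m x * ξ l x) ∂μ) - c (Nat.dist n k) * c (Nat.dist m l)) := by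
    simp only [sq, Finset.sum_mul, Finset.mul_sum]
    simp only [← hval]
    rw [integral_finsetSum _ fun n _ => integrable_finsetSum _ fun k _ =>
      integrable_finsetSum _ fun m _ => integrable_finsetSum _ fun l _ => hi2 _ _ _ _]
    refine Finset.sum_congr rfl fun n _ => ?_
    rw [integral_finsetSum _ fun k _ =>
      integrable_finsetSum _ fun m _ => integrable_finsetSum _ fun l _ => hi2 _ _ _ _]
    refine Finset.sum_congr rfl fun k _ => ?_
    rw [integral_finsetSum _ fun m _ => integrable_finsetSum _ fun l _ => hi2 _ _ _ _]
    refine Finset.sum_congr rfl fun m _ => ?_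
    rw [integral_finsetSum _ fun l _ => hi2 _ _ _ _]
    refine Finset.sum_congr rfl fun l _ => integral_congr_ae (ae_of_all _ fun x => mul_comm _ _)
  have B := h.sum_window_sum_window_dist_le K
  set R := 8 * (∑' i, ρ i) * N * ((K : ℝ) + 1) ^ 2 with hR
  -- Lying in each other's window is a symmetric relation, so exchanging `n` with `k`, or `m` with
  -- `l`, reduces the other three cross distances to `B`.
  have B2 : ∑ n ∈ Finset.range N, ∑ k ∈ window N K n, ∑ m ∈ Finset.range N,
      ∑ _l ∈ window N K m, ρ (Nat.dist m k) ≤ R := by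
    rw [sum_window_comm N K fun n k => ∑ m ∈ Finset.range N,
      ∑ _l ∈ window N K m, ρ (Nat.dist m k)]
    exact B
  have B3 : ∑ n ∈ Finset.range N, ∑ k ∈ window N K n, ∑ m ∈ Finset.range N,
      ∑ l ∈ window N K m, ρ (Nat.dist l n) ≤ R := by
    refine le_of_eq_of_le (Finset.sum_congr rfl fun n _ => Finset.sum_congr rfl fun k _ => ?_) B
    exact sum_window_comm N K fun m l => ρ (Nat.dist l n)
  have B4 : ∑ n ∈ Finset.range N, ∑ k ∈ window N K n, ∑ m ∈ Finset.range N,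
      ∑ l ∈ window N K m, ρ (Nat.dist l k) ≤ R := by
    refine le_of_eq_of_le (Finset.sum_congr rfl fun n _ => Finset.sum_congr rfl fun k _ => ?_) B2
    exact sum_window_comm N K fun m l => ρ (Nat.dist l k)
  rw [hsq]
  calc _ ≤ ∑ n ∈ Finset.range N, ∑ k ∈ window N K n, ∑ m ∈ Finset.range N,
        ∑ l ∈ window N K m, 2 * C * (ρ (Nat.dist m n) + ρ (Nat.dist m k) + ρ (Nat.dist l n) +
          ρ (Nat.dist l k)) := by
        refine Finset.sum_le_sum fun n hn => Finset.sum_le_sum fun k hk =>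
          Finset.sum_le_sum fun m hm => Finset.sum_le_sum fun l hl => ?_
        exact (le_abs_self _).trans (h.abs_cov_pair_le hC2 hC4 (Finset.mem_range.1 hn)
          (mem_window.1 hk).1 (Finset.mem_range.1 hm) (mem_window.1 hl).1)
    _ ≤ 2 * C * (R + R + R + R) := by
        simp only [← Finset.mul_sum, Finset.sum_add_distrib]
        exact mul_le_mul_of_nonneg_left
          (add_le_add (add_le_add (add_le_add B B2) B3) B4) (by positivity)
    _ = _ := by rw [hR]; ring

end IsMixingProcess

/-! ### Coboundaries from bounded Birkhoff sums. -/

/-- A vector whose orbit sums under a bounded operator on a Hilbert space are bounded is a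
coboundary. -/
lemma exists_sub_map_eq_of_bounded {H : Type*} [NormedAddCommGroup H] [InnerProductSpace ℝ H]
    [CompleteSpace H] (U : H →L[ℝ] H) (v : H) (s : ℕ → H) (h0 : s 0 = 0)
    (hs : ∀ n, s (n + 1) = v + U (s n)) {B : ℝ} (hB : ∀ n, ‖s n‖ ≤ B) : ∃ g, v = g - U g := by
  -- The averages satisfy `a n - U (a n) = v - s (n+1) / (n+1) → v`, so any weak limit point of them
  -- solves the equation.
  set a : ℕ → H := fun n => ((n : ℝ) + 1)⁻¹ • ∑ k ∈ Finset.range (n + 1), s k with ha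
  have hpos : ∀ n : ℕ, (0 : ℝ) < (n : ℝ) + 1 := fun n => by positivity
  have hB0 : 0 ≤ B := (norm_nonneg _).trans (hB 0)
  have haB : ∀ n, ‖a n‖ ≤ B := fun n => by
    rw [ha, norm_smul, norm_inv, Real.norm_of_nonneg (hpos n).le, inv_mul_le_iff₀ (hpos n)]
    refine (norm_sum_le_of_le _ fun k _ => hB k).trans_eq ?_
    simp
  have hdiff : ∀ n, a n - U (a n) = v - ((n : ℝ) + 1)⁻¹ • s (n + 1) := fun n => by
    have e : ∑ k ∈ Finset.range (n + 1), s k - U (∑ k ∈ Finset.range (n + 1), s k) =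
        ((n : ℝ) + 1) • v - s (n + 1) := by
      have e1 : ∀ k, s k - U (s k) = v - (s (k + 1) - s k) := fun k => by rw [hs]; abel
      rw [map_sum, ← Finset.sum_sub_distrib, Finset.sum_congr rfl fun k _ => e1 k,
        Finset.sum_sub_distrib, Finset.sum_range_sub, h0, sub_zero, Finset.sum_const,
        Finset.card_range, ← Nat.cast_smul_eq_nsmul ℝ]
      push_cast
      rfl
    rw [ha, map_smul, ← smul_sub, e, smul_sub, smul_smul, inv_mul_cancel₀ (hpos n).ne', one_smul]
  have hlim : Tendsto (fun n => a n - U (a n)) atTop (𝓝 v) := by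
    simp only [hdiff]
    have : Tendsto (fun n : ℕ => ((n : ℝ) + 1)⁻¹ • s (n + 1)) atTop (𝓝 0) := by
      refine squeeze_zero_norm (a := fun n : ℕ => 1 / ((n : ℝ) + 1) * B) (fun n => ?_) ?_
      · rw [norm_smul, norm_inv, Real.norm_of_nonneg (hpos n).le, one_div]
        exact mul_le_mul_of_nonneg_left (hB _) (inv_pos.2 (hpos n)).le
      · simpa using tendsto_one_div_add_atTop_nhds_zero_nat.mul_const B
    simpa using tendsto_const_nhds.sub this
  -- Banach–Alaoglu along an ultrafilter yields a weak limit without extracting a subsequence, so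
  -- `H` need not be separable.
  let F : Ultrafilter ℕ := Ultrafilter.of atTop
  have hF : (F : Filter ℕ) ≤ atTop := Ultrafilter.of_le _
  let d : ℕ → WeakDual ℝ H := fun n =>
    StrongDual.toWeakDual (InnerProductSpace.toDual ℝ H (a n))
  obtain ⟨φ, -, hφ⟩ := (WeakDual.isCompact_closedBall (𝕜 := ℝ) (E := H) 0 B).ultrafilter_le_nhds'
    (F.map d) (by
      refine Ultrafilter.mem_map.2 (univ_mem' fun n => ?_)
      show InnerProductSpace.toDual ℝ H (a n) ∈ Metric.closedBall 0 B
      rw [mem_closedBall_zero_iff, LinearIsometryEquiv.norm_map]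
      exact haB n)
  have hφ' : Tendsto d F (𝓝 φ) := hφ
  set g : H := (InnerProductSpace.toDual ℝ H).symm (WeakDual.toStrongDual φ) with hg
  have hgl : ∀ y, Tendsto (fun n => inner ℝ (a n) y) F (𝓝 (inner ℝ g y)) := fun y => by
    have h1 := ((WeakDual.eval_continuous (𝕜 := ℝ) (E := H) y).tendsto φ).comp hφ'
    have h2 : inner ℝ g y = φ y := by rw [hg, InnerProductSpace.toDual_symm_apply]; rfl
    rw [h2]
    exact h1
  refine ⟨g, ext_inner_right ℝ fun y => ?_⟩
  have h1 : Tendsto (fun n => inner ℝ (a n - U (a n)) y) F (𝓝 (inner ℝ v y)) :=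
    ((hlim.mono_left hF).inner tendsto_const_nhds)
  have h2 : Tendsto (fun n => inner ℝ (a n - U (a n)) y) F (𝓝 (inner ℝ (g - U g) y)) := by
    simp only [inner_sub_left, ← ContinuousLinearMap.adjoint_inner_right U]
    exact (hgl y).sub (hgl _)
  exact tendsto_nhds_unique h1 h2

/-- A bounded function whose Birkhoff sums are bounded in `L²` is a coboundary. -/
lemma isCoboundary_of_bounded {X : Type*} [MeasurableSpace X] {μ : Measure X}
    [IsProbabilityMeasure μ] {T : X → X} (hT : MeasurePreserving T μ μ) {f : X → ℝ}
    (hf : Measurable f) (hbdd : ∃ M : ℝ, ∀ x, |f x| ≤ M) {B : ℝ}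
    (hB : ∀ n, ∫ x, (∑ k ∈ Finset.range n, iter T f k x) ^ 2 ∂μ ≤ B) : IsCoboundary μ T f := by
  obtain ⟨M, hM⟩ := hbdd
  have hmem : ∀ n, MemLp (fun x => ∑ k ∈ Finset.range n, iter T f k x) 2 μ := fun n =>
    memLp_finsetSum _ fun k _ => MemLp.of_bound
      (hf.comp (hT.measurable.iterate k)).aestronglyMeasurable M (ae_of_all _ fun x => hM _)
  have hfm : MemLp f 2 μ := MemLp.of_bound hf.aestronglyMeasurable M (ae_of_all _ hM)
  -- The recursion `S_{n+1} = f + S_n ∘ T`, with the Koopman isometry as `U`.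
  have hrec : ∀ n, (hmem (n + 1)).toLp _ = hfm.toLp f +
      Lp.compMeasurePreserving T hT ((hmem n).toLp _) := fun n => by
    rw [Lp.toLp_compMeasurePreserving, ← MemLp.toLp_add]
    refine MemLp.toLp_congr _ _ (ae_of_all _ fun x => ?_)
    simp only [Pi.add_apply, Function.comp_apply]
    rw [Finset.sum_range_succ', add_comm]
    rfl
  have hnorm : ∀ n, ‖(hmem n).toLp _‖ ≤ √B := fun n => by
    refine Real.le_sqrt_of_sq_le ?_
    rw [← real_inner_self_eq_norm_sq, L2.inner_def]
    refine le_of_eq_of_le (integral_congr_ae ?_) (hB n)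
    filter_upwards [(hmem n).coeFn_toLp] with x hx
    rw [hx]
    simp [sq]
  obtain ⟨g, hg⟩ := exists_sub_map_eq_of_bounded
    (Lp.compMeasurePreservingₗᵢ ℝ (E := ℝ) (p := 2) T hT).toContinuousLinearMap
    (hfm.toLp f) (fun n => (hmem n).toLp _) (by simp) hrec hnorm
  refine ⟨g, Lp.memLp g, ?_⟩
  have h1 := hfm.coeFn_toLp
  have h2 := Lp.coeFn_compMeasurePreserving g hT
  have h3 := Lp.coeFn_sub g (Lp.compMeasurePreserving T hT g)
  have hg' : hfm.toLp f = g - Lp.compMeasurePreserving T hT g := hg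
  rw [← hg'] at h3
  filter_upwards [h1, h2, h3] with x e1 e2 e3
  rw [← e1, e3, Pi.sub_apply, e2, Function.comp_apply]

/-! ### Correlation decay along the orbit, and the second moment of Birkhoff sums. -/

/-- The Birkhoff process of a mixing function is a mixing process. -/
lemma isMixingProcess_iter {X : Type*} [MeasurableSpace X] {μ : Measure X}
    [IsProbabilityMeasure μ] {T : X → X} (hT : MeasurePreserving T μ μ) {f : X → ℝ}
    (hf : Measurable f) (hbdd : ∃ M : ℝ, ∀ x, |f x| ≤ M) {N : ℕ} {C₂ C₄ : ℝ} (hC₂ : 0 < C₂)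
    (hC₄ : 0 < C₄) {ρ : ℕ → ℝ} (hnonneg : ∀ i, 0 ≤ ρ i) (hanti : Antitone ρ) (hzero : ρ 0 = 1)
    (hsum : Summable fun i : ℕ => (i : ℝ) * ρ i)
    (h2 : ∀ k : ℕ, |∫ x, f x * iter T f k x ∂μ| ≤ C₂ * ρ k)
    (h4 : ∀ l m n : ℕ, l ≤ m → m ≤ n → n < N →
      |∫ x, f x * iter T f l x * iter T f m x * iter T f n x ∂μ|
        ≤ C₄ * min (ρ l) (ρ (n - m)))
    (h4' : ∀ l m n : ℕ, l ≤ m → m ≤ n → n < N →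
      |(∫ x, f x * iter T f l x * iter T f m x * iter T f n x ∂μ)
          - (∫ x, f x * iter T f l x ∂μ) * ∫ x, iter T f m x * iter T f n x ∂μ|
        ≤ C₄ * ρ (m - l)) :
    IsMixingProcess μ (iter T f) (fun k => ∫ x, f x * iter T f k x ∂μ) ρ C₂ C₄ N := by
  have hmeas : ∀ n, Measurable (iter T f n) := fun n => hf.comp (hT.measurable.iterate n)
  have hadd : ∀ i j x, iter T f (i + j) x = iter T f j (T^[i] x) := fun i j x => by
    simp only [iter]
    rw [add_comm, Function.iterate_add_apply]
  have hshift : ∀ (i : ℕ) {g : X → ℝ}, Measurable g → ∫ x, g (T^[i] x) ∂μ = ∫ x, g x ∂μ :=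
    fun i g hg => by
      have := integral_map (μ := μ) (hT.iterate i).measurable.aemeasurable
        hg.aestronglyMeasurable
      rw [(hT.iterate i).map_eq] at this
      exact this.symm
  have hcov1 : ∀ i j, i ≤ j →
      ∫ x, iter T f i x * iter T f j x ∂μ = ∫ x, f x * iter T f (j - i) x ∂μ := by
    intro i j hij
    refine Eq.trans ?_ (hshift i (hf.mul (hmeas (j - i))))
    refine integral_congr_ae (ae_of_all _ fun x => ?_)
    simp only
    rw [← hadd, Nat.add_sub_cancel' hij]
    rfl
  have hcov : ∀ i j,
      ∫ x, iter T f i x * iter T f j x ∂μ = ∫ x, f x * iter T f (Nat.dist i j) x ∂μ := by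
    intro i j
    rcases le_total i j with hij | hji
    · rw [hcov1 i j hij, Nat.dist_eq_sub_of_le hij]
    · rw [Nat.dist_eq_sub_of_le_right hji, ← hcov1 j i hji]
      exact integral_congr_ae (ae_of_all _ fun x => mul_comm _ _)
  have hfour : ∀ i j k l, i ≤ j → j ≤ k → k ≤ l →
      ∫ x, iter T f i x * iter T f j x * (iter T f k x * iter T f l x) ∂μ =
        ∫ x, f x * iter T f (j - i) x * iter T f (k - i) x * iter T f (l - i) x ∂μ := by
    intro i j k l hij hjk hkl
    refine Eq.trans ?_
      (hshift i (((hf.mul (hmeas (j - i))).mul (hmeas (k - i))).mul (hmeas (l - i))))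
    refine integral_congr_ae (ae_of_all _ fun x => ?_)
    simp only
    rw [← hadd, ← hadd, ← hadd, Nat.add_sub_cancel' hij, Nat.add_sub_cancel' (hij.trans hjk),
      Nat.add_sub_cancel' ((hij.trans hjk).trans hkl), ← mul_assoc]
    rfl
  refine ⟨hmeas, ?_, hcov, h2, ?_, ?_, hnonneg, hanti, hzero, ?_, hC₂, hC₄⟩
  · obtain ⟨M, hM⟩ := hbdd
    exact ⟨M, fun n x => hM _⟩
  · intro i j k l hij hjk hkl hl
    rw [hfour i j k l hij hjk hkl]
    exact (h4 _ _ _ (by omega) (by omega) (by omega)).trans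
      (mul_le_mul_of_nonneg_left (min_le_left _ _) hC₄.le)
  · intro i j k l hij hjk hkl hl
    have := h4' (j - i) (k - i) (l - i) (by omega) (by omega) (by omega)
    rw [hfour i j k l hij hjk hkl, ← hcov i j, ← hcov k l, hcov1 i j hij]
    rw [hcov1 _ _ (show k - i ≤ l - i by omega)] at this
    rw [hcov1 k l hkl]
    rw [show l - i - (k - i) = l - k by omega, show k - i - (j - i) = k - j by omega] at this
    exact this
  -- The index is shifted because the weight `i` dominates 1 only from `i = 1` on.
  · refine (summable_nat_add_iff 1).1 (Summable.of_nonneg_of_le (fun i => hnonneg _)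
      (fun i => ?_) ((summable_nat_add_iff 1).2 hsum))
    refine le_mul_of_one_le_left (hnonneg _) ?_
    push_cast
    have : (0 : ℝ) ≤ i := Nat.cast_nonneg i
    linarith

namespace IsMixingProcess

variable {X : Type*} [MeasurableSpace X] {μ : Measure X} [IsProbabilityMeasure μ]
  {ξ : ℕ → X → ℝ} {c ρ : ℕ → ℝ} {C₂ C₄ : ℝ} {N : ℕ}

/-- With gap `L` every window is all of `[0, L)`, so only boundary tails are lost and the error does
not grow with `L`. -/
lemma abs_variance_sub_integral_le (h : IsMixingProcess μ ξ c ρ C₂ C₄ N)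
    (hsum : Summable fun i : ℕ => (i : ℝ) * ρ i) (L : ℕ) :
    |L * (c 0 + 2 * ∑' i, c (i + 1)) - ∫ x, (∑ k ∈ Finset.range L, ξ k x) ^ 2 ∂μ| ≤
      2 * C₂ * ∑' i : ℕ, (i : ℝ) * ρ i := by
  have e : ∀ n ∈ Finset.range L, window L L n = Finset.range L := fun n hn => by
    ext k
    rw [mem_window]
    rw [Finset.mem_range] at hn ⊢
    omega
  have h1 : ∫ x, (∑ k ∈ Finset.range L, ξ k x) ^ 2 ∂μ =
      ∑ n ∈ Finset.range L, ∑ k ∈ window L L n, c (Nat.dist n k) := by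
    rw [h.integral_sq_sum]
    exact Finset.sum_congr rfl fun n hn => by rw [e n hn]
  have e2 : L * (c 0 + 2 * ∑' i, c (i + 1)) - ∫ x, (∑ k ∈ Finset.range L, ξ k x) ^ 2 ∂μ =
      ∑ n ∈ Finset.range L, ((c 0 + 2 * ∑' i, c (i + 1)) -
        ∑ k ∈ window L L n, c (Nat.dist n k)) := by
    rw [h1, Finset.sum_sub_distrib, Finset.sum_const, Finset.card_range, nsmul_eq_mul]
  rw [e2]
  calc _ ≤ ∑ n ∈ Finset.range L, C₂ * (tailSum ρ (n + 1) + tailSum ρ (L - 1 - n + 1)) := by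
        refine (Finset.abs_sum_le_sum_abs _ _).trans (Finset.sum_le_sum fun n hn => ?_)
        rw [Finset.mem_range] at hn
        have := h.abs_cov_window_sub_le (K := L) hn
        rwa [min_eq_right hn.le, min_eq_right (by omega : L - 1 - n ≤ L)] at this
    _ = C₂ * (∑ n ∈ Finset.range L, tailSum ρ (n + 1) +
          ∑ n ∈ Finset.range L, tailSum ρ (L - 1 - n + 1)) := by
        rw [← Finset.mul_sum, Finset.sum_add_distrib]
    _ ≤ C₂ * (∑' i : ℕ, (i : ℝ) * ρ i + ∑' i : ℕ, (i : ℝ) * ρ i) :=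
        mul_le_mul_of_nonneg_left (add_le_add (sum_tailSum_le h.nonneg h.summable hsum L)
          (h.sum_tailSum_reflect_le hsum L)) h.C₂_pos.le
    _ = _ := by ring

/-- If the limit variance is not positive, the partial sums are bounded in `L²`. -/
lemma integral_sq_sum_le_of_variance_nonpos (h : IsMixingProcess μ ξ c ρ C₂ C₄ N)
    (hsum : Summable fun i : ℕ => (i : ℝ) * ρ i) (hv : c 0 + 2 * ∑' i, c (i + 1) ≤ 0) (L : ℕ) :
    ∫ x, (∑ k ∈ Finset.range L, ξ k x) ^ 2 ∂μ ≤ 2 * C₂ * ∑' i : ℕ, (i : ℝ) * ρ i := by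
  have h1 := (abs_le.1 (h.abs_variance_sub_integral_le hsum L)).1
  have h2 := mul_nonpos_of_nonneg_of_nonpos (Nat.cast_nonneg (α := ℝ) L) hv
  linarith

end IsMixingProcess

/-! ### Bounded functions and the `L¹` estimate for the windowed quadratic sums. -/

/-- Bounded measurable real functions. -/
def IsBddMeas {X : Type*} [MeasurableSpace X] (g : X → ℝ) : Prop :=
  Measurable g ∧ ∃ M, ∀ x, |g x| ≤ M

namespace IsBddMeas

variable {X : Type*} [MeasurableSpace X] {g k : X → ℝ}

lemma const (a : ℝ) : IsBddMeas fun _ : X => a := ⟨measurable_const, |a|, fun _ => le_rfl⟩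

lemma add (hg : IsBddMeas g) (hk : IsBddMeas k) : IsBddMeas fun x => g x + k x := by
  obtain ⟨hgm, M, hM⟩ := hg
  obtain ⟨hkm, L, hL⟩ := hk
  exact ⟨hgm.add hkm, M + L, fun x => (abs_add_le _ _).trans (add_le_add (hM x) (hL x))⟩

lemma sub (hg : IsBddMeas g) (hk : IsBddMeas k) : IsBddMeas fun x => g x - k x := by
  obtain ⟨hgm, M, hM⟩ := hg
  obtain ⟨hkm, L, hL⟩ := hk
  exact ⟨hgm.sub hkm, M + L, fun x => (abs_sub _ _).trans (add_le_add (hM x) (hL x))⟩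

lemma mul (hg : IsBddMeas g) (hk : IsBddMeas k) : IsBddMeas fun x => g x * k x := by
  obtain ⟨hgm, M, hM⟩ := hg
  obtain ⟨hkm, L, hL⟩ := hk
  refine ⟨hgm.mul hkm, M * L, fun x => ?_⟩
  rw [abs_mul]
  exact mul_le_mul (hM x) (hL x) (abs_nonneg _) ((abs_nonneg _).trans (hM x))

lemma sum {ι : Type*} {g : ι → X → ℝ} (s : Finset ι) (hg : ∀ i, IsBddMeas (g i)) :
    IsBddMeas fun x => ∑ i ∈ s, g i x := by
  classical
  induction s using Finset.induction_on with
  | empty => simpa using const 0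
  | insert a s ha ih => simpa only [Finset.sum_insert ha] using (hg a).add ih

lemma comp {A : ℝ → ℝ} (hA : Continuous A) {b : ℝ} (hb : ∀ x, |A x| ≤ b) (hg : IsBddMeas g) :
    IsBddMeas fun x => A (g x) := ⟨hA.measurable.comp hg.1, b, fun _ => hb _⟩

lemma integrable (hg : IsBddMeas g) (μ : Measure X) [IsProbabilityMeasure μ] :
    Integrable g μ := by
  obtain ⟨hgm, M, hM⟩ := hg
  exact Integrable.of_bound hgm.aestronglyMeasurable M (ae_of_all _ hM)

end IsBddMeas

/-- The Cauchy–Schwarz bound of the `L¹` norm by the `L²` norm. -/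
lemma integral_abs_le_sqrt {X : Type*} [MeasurableSpace X] {μ : Measure X}
    [IsProbabilityMeasure μ] {g : X → ℝ} (hg : IsBddMeas g) :
    ∫ x, |g x| ∂μ ≤ √(∫ x, g x ^ 2 ∂μ) := by
  refine Real.le_sqrt_of_sq_le ?_
  have hi := (hg.integrable μ).abs
  have hi2 : Integrable (fun x => g x ^ 2) μ := by
    simpa only [sq] using (hg.mul hg).integrable μ
  set a := ∫ x, |g x| ∂μ with ha
  have h0 : 0 ≤ ∫ x, (g x ^ 2 - 2 * a * |g x| + a ^ 2) ∂μ := by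
    refine integral_nonneg fun x => ?_
    have : g x ^ 2 - 2 * a * |g x| + a ^ 2 = (|g x| - a) ^ 2 := by rw [← sq_abs (g x)]; ring
    simp only [this]
    exact sq_nonneg _
  have hi3 : Integrable (fun x => g x ^ 2 - 2 * a * |g x|) μ := hi2.sub (hi.const_mul _)
  rw [integral_add hi3 (integrable_const _),
    integral_sub hi2 (hi.const_mul _), integral_const_mul, ← ha] at h0
  simp only [integral_const, probReal_univ, smul_eq_mul, one_mul] at h0
  linarith

namespace IsMixingProcess

variable {X : Type*} [MeasurableSpace X] {μ : Measure X} [IsProbabilityMeasure μ]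
  {ξ : ℕ → X → ℝ} {c ρ : ℕ → ℝ} {C₂ C₄ : ℝ} {N : ℕ}

/-- `L¹` distance of the normalised windowed quadratic sums to the limit variance. -/
lemma integral_abs_variance_sub_le (h : IsMixingProcess μ ξ c ρ C₂ C₄ N)
    (hsum : Summable fun i : ℕ => (i : ℝ) * ρ i) {D : ℝ} (hC2 : C₂ ≤ D) (hC4 : C₄ ≤ D ^ 2)
    (hN : 0 < N) (K : ℕ) :
    ∫ x, |(c 0 + 2 * ∑' i, c (i + 1)) -
        (N : ℝ)⁻¹ * ∑ n ∈ Finset.range N, ∑ k ∈ window N K n, ξ n x * ξ k x| ∂μ ≤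
      2 * C₂ * (tailSum ρ (K + 1) + (N : ℝ)⁻¹ * ∑' i : ℕ, (i : ℝ) * ρ i) +
        8 * D * (∑' i, ρ i) * ((K + 1) / √N) := by
  have hN' : (0 : ℝ) < N := Nat.cast_pos.2 hN
  have hD : 0 ≤ D := h.C₂_pos.le.trans hC2
  have hb : ∀ n, IsBddMeas (ξ n) := fun n => ⟨h.meas n, h.bdd.imp fun M hM => hM n⟩
  set v := c 0 + 2 * ∑' i, c (i + 1) with hv
  set m := ∑ n ∈ Finset.range N, ∑ k ∈ window N K n, c (Nat.dist n k) with hm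
  set Y : X → ℝ := fun x => ∑ n ∈ Finset.range N, ∑ k ∈ window N K n,
    (ξ n x * ξ k x - c (Nat.dist n k)) with hY
  have hYb : IsBddMeas Y := .sum _ fun n => .sum _ fun k => ((hb n).mul (hb k)).sub (.const _)
  have hS0 : 1 ≤ ∑' i, ρ i := h.zero ▸ h.summable.le_tsum 0 fun i _ => h.nonneg i
  -- The square root of the variance bound with `C = D ^ 2`; since `∑ ρ ≥ ρ 0 = 1`, the root of `∑
  -- ρ` may be replaced by `∑ ρ`.
  have hYint : ∫ x, |Y x| ∂μ ≤ 8 * D * (∑' i, ρ i) * √N * (K + 1) := by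
    refine (integral_abs_le_sqrt hYb).trans (Real.sqrt_le_iff.2 ⟨by positivity, ?_⟩)
    refine (h.integral_sq_window_le (C := D ^ 2) (pow_le_pow_left₀ h.C₂_pos.le hC2 2)
      hC4 K).trans ?_
    have e : (8 * D * (∑' i, ρ i) * √N * (K + 1)) ^ 2 =
        64 * D ^ 2 * (∑' i, ρ i) * N * ((K : ℝ) + 1) ^ 2 * ∑' i, ρ i := by
      have := Real.sq_sqrt hN'.le
      linear_combination 64 * D ^ 2 * (∑' i, ρ i) ^ 2 * ((K : ℝ) + 1) ^ 2 * this
    rw [e]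
    exact le_mul_of_one_le_right (by positivity) hS0
  have hmean : |v - (N : ℝ)⁻¹ * m| ≤
      2 * C₂ * (tailSum ρ (K + 1) + (N : ℝ)⁻¹ * ∑' i : ℕ, (i : ℝ) * ρ i) := by
    have h1 := mul_le_mul_of_nonneg_left (h.abs_variance_sub_window_le hsum N K)
      (inv_pos.2 hN').le
    rw [← hv, ← hm] at h1
    calc |v - (N : ℝ)⁻¹ * m| = (N : ℝ)⁻¹ * |N * v - m| := by
          rw [← abs_of_pos (inv_pos.2 hN'), ← abs_mul, abs_of_pos (inv_pos.2 hN')]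
          congr 1
          field_simp
      _ ≤ _ := h1
      _ = _ := by field_simp
  have hpt : ∀ x, |v - (N : ℝ)⁻¹ * ∑ n ∈ Finset.range N, ∑ k ∈ window N K n, ξ n x * ξ k x| ≤
      |v - (N : ℝ)⁻¹ * m| + (N : ℝ)⁻¹ * |Y x| := fun x => by
    have e : v - (N : ℝ)⁻¹ * ∑ n ∈ Finset.range N, ∑ k ∈ window N K n, ξ n x * ξ k x =
        (v - (N : ℝ)⁻¹ * m) - (N : ℝ)⁻¹ * Y x := by
      simp only [hY, hm, Finset.sum_sub_distrib]
      ring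
    rw [e]
    refine (abs_sub _ _).trans_eq ?_
    rw [abs_mul (N : ℝ)⁻¹, abs_of_pos (inv_pos.2 hN')]
  have hVb : IsBddMeas fun x => v - (N : ℝ)⁻¹ * ∑ n ∈ Finset.range N, ∑ k ∈ window N K n,
      ξ n x * ξ k x :=
    .sub (.const v) (.mul (.const _) (.sum _ fun n => .sum _ fun k => (hb n).mul (hb k)))
  calc _ ≤ ∫ x, (|v - (N : ℝ)⁻¹ * m| + (N : ℝ)⁻¹ * |Y x|) ∂μ :=
        integral_mono (hVb.integrable μ).abs
          ((integrable_const _).add ((hYb.integrable μ).abs.const_mul _)) hpt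
    _ = |v - (N : ℝ)⁻¹ * m| + (N : ℝ)⁻¹ * ∫ x, |Y x| ∂μ := by
        rw [integral_add (integrable_const _) ((hYb.integrable μ).abs.const_mul _),
          integral_const_mul]
        simp
    _ ≤ |v - (N : ℝ)⁻¹ * m| + (N : ℝ)⁻¹ * (8 * D * (∑' i, ρ i) * √N * (K + 1)) :=
        add_le_add le_rfl (mul_le_mul_of_nonneg_left hYint (inv_pos.2 hN').le)
    _ ≤ _ := by
        refine add_le_add hmean (le_of_eq ?_)
        have h1 := Real.sq_sqrt hN'.le
        have h2 : √(N : ℝ) ≠ 0 := (Real.sqrt_pos.2 hN').ne'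
        field_simp
        rw [h1, mul_comm]

/-- The expectation of the Stein operator under a normalised sum of a mixing process. -/
lemma abs_integral_stein_le (h : IsMixingProcess μ ξ c ρ C₂ C₄ N)
    (hsum : Summable fun i : ℕ => (i : ℝ) * ρ i) {D : ℝ} (hC2 : C₂ ≤ D) (hC4 : C₄ ≤ D ^ 2)
    (hN : 0 < N) (K : ℕ) {M : ℝ} (hM : ∀ n, ∀ᵐ x ∂μ, |ξ n x| ≤ M)
    {A A' : ℝ → ℝ} {a b₁ b₂ δ : ℝ} (hd : ∀ x, HasDerivAt A (A' x) x) (hA : ∀ x, |A x| ≤ a)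
    (hA' : ∀ x, |A' x| ≤ b₁) (hL : ∀ x y, |A' x - A' y| ≤ 2 * b₂ * |x - y|) (hb₂ : 0 ≤ b₂)
    {w : X → ℝ} (hw : ∀ x, w x = 1 / √N * ∑ n ∈ Finset.range N, ξ n x)
    {g : ℕ → X → ℝ} (hg : ∀ n x, g n x = w x - 1 / √N * ∑ k ∈ window N K n, ξ k x)
    (hδ : ∀ n < N, |∫ x, ξ n x * A (g n x) ∂μ| ≤ δ) :
    |∫ x, ((c 0 + 2 * ∑' i, c (i + 1)) * A' (w x) - w x * A (w x)) ∂μ| ≤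
      b₁ * (2 * C₂ * (tailSum ρ (K + 1) + (N : ℝ)⁻¹ * ∑' i : ℕ, (i : ℝ) * ρ i) +
        8 * D * (∑' i, ρ i) * ((K + 1) / √N)) + √N * δ +
          4 * M * b₂ * C₂ * (∑' i, ρ i) * ((K + 1) / √N) := by
  have hN' : (0 : ℝ) < N := Nat.cast_pos.2 hN
  have hsN : 0 < √(N : ℝ) := Real.sqrt_pos.2 hN'
  have hsq : √(N : ℝ) ^ 2 = N := Real.sq_sqrt hN'.le
  have hb : ∀ n, IsBddMeas (ξ n) := fun n => ⟨h.meas n, h.bdd.imp fun M hM => hM n⟩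
  have hb₁ : 0 ≤ b₁ := (abs_nonneg _).trans (hA' 0)
  have hM0 : 0 ≤ M := by
    obtain ⟨x, hx⟩ := (hM 0).exists
    exact (abs_nonneg _).trans hx
  have hS0 : 0 ≤ ∑' i, ρ i := tsum_nonneg h.nonneg
  have hAc : Continuous A := continuous_iff_continuousAt.2 fun x => (hd x).continuousAt
  have hAc' : Continuous A' := continuous_of_abs_sub_le hL
  set r := 1 / √(N : ℝ) with hr
  have hr0 : 0 < r := by positivity
  have hr2 : r ^ 2 = (N : ℝ)⁻¹ := by rw [hr, div_pow, hsq, one_pow, one_div]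
  have hwb : IsBddMeas w := by
    rw [show w = fun x => r * ∑ n ∈ Finset.range N, ξ n x from funext hw]
    exact .mul (.const _) (.sum _ hb)
  have hgb : ∀ n, IsBddMeas (g n) := fun n => by
    rw [show g n = fun x => w x - r * ∑ k ∈ window N K n, ξ k x from funext (hg n)]
    exact hwb.sub (.mul (.const _) (.sum _ hb))
  set v := c 0 + 2 * ∑' i, c (i + 1) with hv
  set V : X → ℝ := fun x => v - (N : ℝ)⁻¹ * ∑ n ∈ Finset.range N, ∑ k ∈ window N K n,
    ξ n x * ξ k x with hV
  have hVb : IsBddMeas V :=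
    .sub (.const v) (.mul (.const _) (.sum _ fun n => .sum _ fun k => (hb n).mul (hb k)))
  set R : ℕ → X → ℝ := fun n x => A (w x) - A (g n x) - A' (w x) * (w x - g n x) with hR
  have hAw : IsBddMeas fun x => A (w x) := .comp hAc hA hwb
  have hAw' : IsBddMeas fun x => A' (w x) := .comp hAc' hA' hwb
  have hAg : ∀ n, IsBddMeas fun x => A (g n x) := fun n => .comp hAc hA (hgb n)
  have hRb : ∀ n, IsBddMeas (R n) := fun n =>
    (hAw.sub (hAg n)).sub (hAw'.mul (hwb.sub (hgb n)))
  -- Expansion of each `A (w x)` at `g n x`. The linear terms involve `w - g n`, a window sum, and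
  -- recombine with `v * A'` into `A' * V`.
  have hsplit : ∀ x, v * A' (w x) - w x * A (w x) =
      A' (w x) * V x - r * ∑ n ∈ Finset.range N, ξ n x * A (g n x) -
        r * ∑ n ∈ Finset.range N, ξ n x * R n x := fun x => by
    have e1 : ∀ n, ξ n x * A (w x) = ξ n x * A (g n x) + ξ n x * R n x +
        r * A' (w x) * ∑ k ∈ window N K n, ξ n x * ξ k x := fun n => by
      rw [← Finset.mul_sum]
      have e2 : w x - g n x = r * ∑ k ∈ window N K n, ξ k x := by rw [hg]; ring
      simp only [hR, e2]
      ring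
    have e3 : w x * A (w x) = r * ∑ n ∈ Finset.range N, ξ n x * A (w x) := by
      rw [← Finset.sum_mul]
      nth_rewrite 1 [hw x]
      ring
    rw [e3, Finset.sum_congr rfl fun n _ => e1 n, Finset.sum_add_distrib,
      Finset.sum_add_distrib, ← Finset.mul_sum]
    simp only [hV]
    rw [← hr2]
    ring
  have i1 : Integrable (fun x => A' (w x) * V x) μ := (hAw'.mul hVb).integrable μ
  have i2 : ∀ n, Integrable (fun x => ξ n x * A (g n x)) μ := fun n =>
    ((hb n).mul (hAg n)).integrable μ
  have i3 : ∀ n, Integrable (fun x => ξ n x * R n x) μ := fun n =>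
    ((hb n).mul (hRb n)).integrable μ
  have i2s := (integrable_finsetSum (Finset.range N) fun n _ => i2 n).const_mul r
  have i3s := (integrable_finsetSum (Finset.range N) fun n _ => i3 n).const_mul r
  have i12 : Integrable (fun x => A' (w x) * V x -
      r * ∑ n ∈ Finset.range N, ξ n x * A (g n x)) μ := i1.sub i2s
  have hval : ∫ x, (v * A' (w x) - w x * A (w x)) ∂μ =
      ∫ x, A' (w x) * V x ∂μ - r * ∑ n ∈ Finset.range N, ∫ x, ξ n x * A (g n x) ∂μ -
        r * ∑ n ∈ Finset.range N, ∫ x, ξ n x * R n x ∂μ := by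
    simp only [hsplit]
    rw [integral_sub i12 i3s, integral_sub i1 i2s, integral_const_mul,
      integral_const_mul, integral_finsetSum _ fun n _ => i2 n,
      integral_finsetSum _ fun n _ => i3 n]
  have hT1 : |∫ x, A' (w x) * V x ∂μ| ≤
      b₁ * (2 * C₂ * (tailSum ρ (K + 1) + (N : ℝ)⁻¹ * ∑' i : ℕ, (i : ℝ) * ρ i) +
        8 * D * (∑' i, ρ i) * ((K + 1) / √N)) := by
    calc _ ≤ ∫ x, |A' (w x) * V x| ∂μ := abs_integral_le_integral_abs
      _ ≤ ∫ x, b₁ * |V x| ∂μ := by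
        refine integral_mono i1.abs ((hVb.integrable μ).abs.const_mul _) fun x => ?_
        simp only [abs_mul]
        exact mul_le_mul_of_nonneg_right (hA' _) (abs_nonneg _)
      _ = b₁ * ∫ x, |V x| ∂μ := integral_const_mul _ _
      _ ≤ _ := mul_le_mul_of_nonneg_left
        (h.integral_abs_variance_sub_le hsum hC2 hC4 hN K) hb₁
  have hT2 : |r * ∑ n ∈ Finset.range N, ∫ x, ξ n x * A (g n x) ∂μ| ≤ √N * δ := by
    rw [abs_mul, abs_of_pos hr0]
    calc _ ≤ r * ∑ _n ∈ Finset.range N, δ := by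
          refine mul_le_mul_of_nonneg_left ((Finset.abs_sum_le_sum_abs _ _).trans
            (Finset.sum_le_sum fun n hn => hδ n (Finset.mem_range.1 hn))) hr0.le
      _ = √N * δ := by
          rw [Finset.sum_const, Finset.card_range, nsmul_eq_mul, hr]
          nth_rewrite 2 [← hsq]
          field_simp
  have hT3 : |r * ∑ n ∈ Finset.range N, ∫ x, ξ n x * R n x ∂μ| ≤
      4 * M * b₂ * C₂ * (∑' i, ρ i) * ((K + 1) / √N) := by
    -- The factor `N⁻¹` is the squared normalisation, `2(K+1)` the size of the window, and `2 C₂ ∑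
    -- ρ` the second moment per summand.
    have hone : ∀ n, |∫ x, ξ n x * R n x ∂μ| ≤
        M * b₂ * (N : ℝ)⁻¹ * (2 * (K + 1) * (2 * C₂ * ∑' i, ρ i)) := fun n => by
      have i4 : Integrable (fun x => (∑ k ∈ window N K n, ξ k x) ^ 2) μ := by
        have : IsBddMeas fun x => ∑ k ∈ window N K n, ξ k x := .sum _ hb
        simpa only [sq] using (this.mul this).integrable μ
      calc _ ≤ ∫ x, |ξ n x * R n x| ∂μ := abs_integral_le_integral_abs
        _ ≤ ∫ x, M * b₂ * (N : ℝ)⁻¹ * (∑ k ∈ window N K n, ξ k x) ^ 2 ∂μ := by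
          refine integral_mono_ae (i3 n).abs (i4.const_mul _) ?_
          filter_upwards [hM n] with x hx
          have h1 : |R n x| ≤ b₂ * (w x - g n x) ^ 2 := abs_taylor_le hd hL _ _
          have e2 : w x - g n x = r * ∑ k ∈ window N K n, ξ k x := by rw [hg]; ring
          rw [e2, mul_pow, hr2] at h1
          rw [abs_mul]
          refine (mul_le_mul hx h1 (abs_nonneg _) hM0).trans_eq ?_
          ring
        _ = M * b₂ * (N : ℝ)⁻¹ * ∫ x, (∑ k ∈ window N K n, ξ k x) ^ 2 ∂μ :=
          integral_const_mul _ _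
        _ ≤ _ := by
          refine mul_le_mul_of_nonneg_left ((h.integral_sq_sum_le _).trans ?_) (by positivity)
          refine mul_le_mul_of_nonneg_right (card_window_le _ _ _) ?_
          have := h.C₂_pos
          positivity
    rw [abs_mul, abs_of_pos hr0]
    calc _ ≤ r * ∑ _n ∈ Finset.range N,
          M * b₂ * (N : ℝ)⁻¹ * (2 * (K + 1) * (2 * C₂ * ∑' i, ρ i)) :=
          mul_le_mul_of_nonneg_left ((Finset.abs_sum_le_sum_abs _ _).trans
            (Finset.sum_le_sum fun n _ => hone n)) hr0.le
      _ = _ := by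
          rw [Finset.sum_const, Finset.card_range, nsmul_eq_mul, hr]
          field_simp
          ring
  rw [hval]
  exact (abs_sub _ _).trans (add_le_add ((abs_sub _ _).trans (add_le_add hT1 hT2)) hT3)

end IsMixingProcess

/-- The norm is an essential supremum, so the bound holds off a null set, whose preimage under
`T^[n]` is null by invariance. -/
lemma ae_abs_iter_le_supNorm {X : Type*} [MeasurableSpace X] {μ : Measure X}
    [IsProbabilityMeasure μ] {T : X → X} (hT : MeasurePreserving T μ μ) {f : X → ℝ}
    (hbdd : ∃ M : ℝ, ∀ x, |f x| ≤ M) (hf : Measurable f) (n : ℕ) :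
    ∀ᵐ x ∂μ, |iter T f n x| ≤ supNorm μ f := by
  obtain ⟨M, hM⟩ := hbdd
  have hfin : eLpNorm f ∞ μ ≠ ∞ :=
    (MemLp.of_bound (p := ∞) hf.aestronglyMeasurable M (ae_of_all _ hM)).eLpNorm_ne_top
  have h1 : ∀ᵐ x ∂μ, |f x| ≤ supNorm μ f := by
    have h2 : ∀ᵐ x ∂μ, ‖f x‖ₑ ≤ eLpNorm f ∞ μ := by
      rw [eLpNorm_exponent_top]
      exact enorm_ae_le_eLpNormEssSup f μ
    filter_upwards [h2] with x hx
    have := ENNReal.toReal_mono hfin hx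
    rwa [toReal_enorm] at this
  exact (hT.iterate n).quasiMeasurePreserving.ae h1

/-- Lets the single scale `Csharp' σ` dominate the bounds on `A`, `A'` and `A''` together. -/
lemma inv_le_max_one_inv_sq (σ : ℝ) : σ⁻¹ ≤ max 1 (σ ^ 2)⁻¹ := by
  rw [← inv_pow]
  rcases le_total σ⁻¹ 1 with h | h
  · exact h.trans (le_max_left _ _)
  · exact (by nlinarith : σ⁻¹ ≤ σ⁻¹ ^ 2).trans (le_max_right _ _)

end SteinDyn

theorem theorem2p3 {X : Type*} [MeasurableSpace X] (μ : Measure X) [IsProbabilityMeasure μ]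
    (T : X → X) (hT : MeasurePreserving T μ μ)
    (f : X → ℝ) (hf_meas : Measurable f) (hf_bdd : ∃ M : ℝ, ∀ x, |f x| ≤ M)
    (hf_mean : ∫ x, f x ∂μ = 0)
    (N K : ℕ) (hN : 0 < N) (hK : K < N)
    -- decay of correlations of orders two and four
    (C₂ C₄ : ℝ) (hC₂ : 0 < C₂) (hC₄ : 0 < C₄)
    (ρ : ℕ → ℝ) (hρ_nonneg : ∀ i, 0 ≤ ρ i) (hρ_anti : Antitone ρ) (hρ_zero : ρ 0 = 1)
    (hρ_sum : Summable fun i : ℕ => (i : ℝ) * ρ i)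
    (hB1₂ : ∀ k : ℕ, |∫ x, f x * SteinDyn.iter T f k x ∂μ| ≤ C₂ * ρ k)
    (hB1₄ : ∀ l m n : ℕ, l ≤ m → m ≤ n → n < N →
      |∫ x, f x * SteinDyn.iter T f l x * SteinDyn.iter T f m x * SteinDyn.iter T f n x ∂μ|
        ≤ C₄ * min (ρ l) (ρ (n - m)))
    (hB1₄' : ∀ l m n : ℕ, l ≤ m → m ≤ n → n < N →
      |(∫ x, f x * SteinDyn.iter T f l x * SteinDyn.iter T f m x * SteinDyn.iter T f n x ∂μ)
          - (∫ x, f x * SteinDyn.iter T f l x ∂μ)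
            * ∫ x, SteinDyn.iter T f m x * SteinDyn.iter T f n x ∂μ|
        ≤ C₄ * ρ (m - l))
    -- decorrelation of `f^n` from regular functions of `W^n`
    (ρt : ℕ → ℝ) (hρt_nonneg : ∀ i, 0 ≤ ρt i)
    (hB2 : ∀ A : ℝ → ℝ, SteinDyn.IsTestFun A → ∀ n : ℕ, n < N →
      |∫ x, SteinDyn.iter T f n x * A (SteinDyn.Wgap T f N K n x) ∂μ| ≤ ρt K)
    -- non-degeneracy
    (hB3 : ¬ SteinDyn.IsCoboundary μ T f) :
    (Summable fun n : ℕ => ∫ x, f x * SteinDyn.iter T f (n + 1) x ∂μ) ∧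
    0 < SteinDyn.variance μ T f ∧
    ∀ σ : ℝ, 0 < σ → σ ^ 2 = SteinDyn.variance μ T f →
      SteinDyn.wassersteinDist (μ.map (SteinDyn.W T f N)) (gaussianReal 0 (Real.toNNReal (σ ^ 2)))
        ≤ ENNReal.ofReal
          (SteinDyn.Csharp σ C₂ C₄ (SteinDyn.supNorm μ f) ρ
              * (((K : ℝ) + 1) / √(N : ℝ) + ∑' i : ℕ, ρ (K + 1 + i))
            + SteinDyn.Csharp' σ * √(N : ℝ) * ρt K) := by
  open SteinDyn in
  have h := isMixingProcess_iter hT hf_meas hf_bdd hC₂ hC₄ hρ_nonneg hρ_anti hρ_zero hρ_sum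
    hB1₂ hB1₄ hB1₄'
  set c : ℕ → ℝ := fun k => ∫ x, f x * iter T f k x ∂μ with hc
  have hvar : SteinDyn.variance μ T f = c 0 + 2 * ∑' i, c (i + 1) := rfl
  refine ⟨h.summable_cov, ?_, fun σ hσ hσv => ?_⟩
  · by_contra hneg
    exact hB3 (isCoboundary_of_bounded hT hf_meas hf_bdd
      (h.integral_sq_sum_le_of_variance_nonpos hρ_sum (not_lt.1 hneg)))
  have hWm : Measurable (W T f N) :=
    (Finset.measurable_fun_sum _ fun k _ => h.meas k).const_mul _
  have hWb : IsBddMeas (W T f N) := .mul (.const _) (.sum _ fun n =>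
    ⟨h.meas n, h.bdd.imp fun M hM => hM n⟩)
  refine iSup₂_le fun k hk => ENNReal.ofReal_le_ofReal ?_
  have hkc : Continuous k := continuous_of_abs_sub_le (c := 1) (by simpa using hk)
  obtain ⟨A, A', hd, hA, hA', hL, heq⟩ := exists_stein hk hσ
  set b := SteinDyn.Csharp' σ with hbdef
  have hb1 : 1 ≤ b := by
    have := le_max_left 1 (σ ^ 2)⁻¹
    rw [hbdef, Csharp']; linarith
  have hb0 : 0 < b := one_pos.trans_le hb1
  have htest : IsTestFun fun x => b⁻¹ * A x := by
    refine isTestFun_of_bounds hd hb0 (fun x => (hA x).trans hb1) (fun x => (hA' x).trans ?_)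
      fun x y => (hL x y).trans (mul_le_mul_of_nonneg_right ?_ (abs_nonneg _))
    · have := inv_le_max_one_inv_sq σ
      have h0 := inv_pos.2 hσ
      rw [hbdef, Csharp']; linarith
    · rw [hbdef, Csharp']
      exact mul_le_mul_of_nonneg_left (le_max_right _ _) zero_le_two
  set D := max C₂ (√C₄) with hD
  have hD0 : 0 < D := hC₂.trans_le (le_max_left _ _)
  have hCD : C₄ ≤ D ^ 2 := by
    rw [← Real.sq_sqrt hC₄.le]
    exact pow_le_pow_left₀ (Real.sqrt_nonneg _) (le_max_right _ _) 2
  -- Condition (B2) is applied to `b⁻¹ * A`, hence `δ = b * ρt K`.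
  have hmain := h.abs_integral_stein_le hρ_sum (le_max_left C₂ (√C₄)) hCD hN K
    (ae_abs_iter_le_supNorm hT hf_bdd hf_meas) hd hA hA' (b₂ := (σ ^ 2)⁻¹) (δ := b * ρt K) hL
    (by positivity) (w := W T f N) (fun x => rfl) (g := Wgap T f N K) (fun n x => rfl)
    (fun n hn => by
      have := hB2 _ htest n hn
      simp only [mul_left_comm _ b⁻¹] at this
      rwa [integral_const_mul, abs_mul, abs_of_pos (inv_pos.2 hb0), inv_mul_le_iff₀ hb0] at this)
  have hint : Integrable (fun x => k (W T f N x)) μ := by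
    obtain ⟨-, M, hM⟩ := hWb
    refine Integrable.of_bound (hkc.measurable.comp hWm).aestronglyMeasurable (|k 0| + M)
      (ae_of_all _ fun x => ?_)
    have h1 := hk (W T f N x) 0
    rw [sub_zero] at h1
    calc ‖k (W T f N x)‖ = |k 0 + (k (W T f N x) - k 0)| := by
          rw [Real.norm_eq_abs]; congr 1; ring
      _ ≤ |k 0| + |k (W T f N x) - k 0| := abs_add_le _ _
      _ ≤ |k 0| + M := add_le_add le_rfl (h1.trans (hM x))
  rw [← hvar, ← hσv] at hmain
  simp only [heq] at hmain
  rw [integral_sub hint (integrable_const _)] at hmain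
  simp only [integral_const, probReal_univ, one_smul] at hmain
  rw [integral_map hWm.aemeasurable hkc.aestronglyMeasurable]
  refine hmain.trans ?_
  have hNr : (1 : ℝ) ≤ N := by exact_mod_cast hN
  have hsN : 1 ≤ √(N : ℝ) := Real.one_le_sqrt.2 hNr
  have hS : ∑' i : ℕ, ((i : ℝ) + 1) * ρ i = ∑' i : ℕ, (i : ℝ) * ρ i + ∑' i, ρ i := by
    rw [← hρ_sum.tsum_add h.summable]
    simp only [add_mul, one_mul]
  have hB0 : 0 ≤ ∑' i : ℕ, (i : ℝ) * ρ i :=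
    tsum_nonneg fun i => mul_nonneg (Nat.cast_nonneg i) (hρ_nonneg i)
  have hS1 : 1 ≤ ∑' i, ρ i := hρ_zero ▸ h.summable.le_tsum 0 fun i _ => hρ_nonneg i
  have hτ : 0 ≤ tailSum ρ (K + 1) := tailSum_nonneg hρ_nonneg _
  have hM0 : 0 ≤ supNorm μ f := ENNReal.toReal_nonneg
  -- Absorbs the boundary error of order `1/N` into the main rate.
  have hNinv : (N : ℝ)⁻¹ ≤ ((K : ℝ) + 1) / √N := by
    have h1 : (N : ℝ)⁻¹ ≤ 1 / √N := by
      rw [← one_div]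
      exact one_div_le_one_div_of_le (by positivity) (Real.sqrt_le_iff.2 ⟨by positivity, by nlinarith⟩)
    refine h1.trans (div_le_div_of_nonneg_right ?_ (by positivity))
    have : (0 : ℝ) ≤ K := Nat.cast_nonneg K
    linarith
  rw [Csharp, hS, ← hD]
  change _ ≤ _ * (_ + tailSum ρ (K + 1)) + _
  set B := ∑' i : ℕ, (i : ℝ) * ρ i
  set S := ∑' i, ρ i
  set τ := tailSum ρ (K + 1)
  set L := ((K : ℝ) + 1) / √N with hLdef
  have hL0 : 0 ≤ L := by positivity
  set m := max σ⁻¹ (σ ^ 2)⁻¹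
  set M := supNorm μ f
  have hm1 : σ⁻¹ ≤ m := le_max_left _ _
  have hm2 : (σ ^ 2)⁻¹ ≤ m := le_max_right _ _
  have hm0 : 0 < m := (inv_pos.2 hσ).trans_le hm1
  have hCd : C₂ ≤ D := le_max_left _ _
  -- The lone `τ` is dominated by `S * τ` because `S ≥ 1`. Multiplied by `11/8`, the 8 becomes the
  -- 11 of `Csharp`; the Taylor term, with constant 4, fits under the part carrying `‖f‖_∞`.
  have e1 : 2 * C₂ * (τ + (N : ℝ)⁻¹ * B) + 8 * D * S * L ≤ 8 * D * (B + S) * (L + τ) := by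
    have a1 : 2 * C₂ * (τ + (N : ℝ)⁻¹ * B) ≤ 2 * D * (τ + L * B) := by gcongr
    have a2 : τ ≤ S * τ := le_mul_of_one_le_left hτ hS1
    have a3 := mul_nonneg hD0.le (sub_nonneg.2 a2)
    have a4 := mul_nonneg (mul_nonneg hD0.le hB0) hL0
    have a5 := mul_nonneg (mul_nonneg hD0.le hB0) hτ
    have a6 := mul_nonneg hD0.le (hτ.trans a2)
    nlinarith
  have e2 : 11 / 8 * σ⁻¹ * (2 * C₂ * (τ + (N : ℝ)⁻¹ * B) + 8 * D * S * L) ≤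
      11 / 8 * m * (8 * D * (B + S) * (L + τ)) := by
    refine mul_le_mul (by linarith) e1 ?_ (by positivity)
    positivity
  have e3 : 4 * M * (σ ^ 2)⁻¹ * C₂ * S * L ≤ 11 * M * m * D * (B + S) * (L + τ) := by
    gcongr
    · norm_num
    · linarith
    · linarith
  calc _ ≤ 11 / 8 * m * (8 * D * (B + S) * (L + τ)) + √N * (b * ρt K) +
        11 * M * m * D * (B + S) * (L + τ) := add_le_add (add_le_add e2 le_rfl) e3
    _ = _ := by ring
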